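/- Let $k$ be a field, $Q$ a finite quiver (finite sets of vertices and of arrows), $kQ$ its path algebra (paths are composed from right to left), $F\subset kQ$ the ideal generated by the arrows, and $I$ an admissible two-sided ideal, i.e. $F^m\subseteq I\subseteq F^2$ for some $m\ge 2$. Let $\Lambda=kQ/I$ be the corresponding bound quiver algebra. For a vertex $x$ we also write $x\in\Lambda$ for the idempotent given by the trivial path at $x$; ${}_xk$ and $k_x$ denote the simple left and the simple right $\Lambda$-module at $x$. A family $V_*$ of vector spaces is called infinite if $V_n\neq 0$ for infinitely many $n$. The algebra $\Lambda$ has *infinite $+$ global dimension* (resp. *infinite co$+$ global dimension*) if there are vertices $y,x$ of $Q$ such that $y\Lambda x\neq 0$ and $\operatorname{Tor}^\Lambda_*(k_x,{}_yk)$ (resp. $\operatorname{Tor}^\Lambda_*(k_y,{}_xk)$) is infinite. Put $\Lambda^e=\Lambda\otimes_k\Lambda^{\mathrm{op}}$, whose left modules are the $\Lambda$-bimodules, and $D=\operatorname{Hom}_k(-,k)$. For a finitely generated $\Lambda^e$-module $M$ let $\Omega M$ be the kernel of a projective cover of $M$, let $P_1\to P_0\to M\to 0$ be a minimal projective presentation,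 let $\operatorname{Tr}M=\operatorname{coker}\big(\operatorname{Hom}_{\Lambda^e}(P_0,\Lambda^e)\to\operatorname{Hom}_{\Lambda^e}(P_1,\Lambda^e)\big)$ and $\tau M=D\operatorname{Tr}M$. For $n\ge 1$ put $\tau_n=\tau\,\Omega^{n-1}$. The $\tau$-Hochschild cohomology and homology of $\Lambda$ in degree $n\ge 1$ are $$\mathrm{HH}^n_\tau(\Lambda)=D\operatorname{Hom}_{\Lambda^e}(\Lambda,\tau_n\Lambda),\qquad \mathrm{HH}_n^\tau(\Lambda)=\operatorname{Hom}_{\Lambda^e}(D\Lambda,\tau_n\Lambda).$$ Then: 1. $\Lambda$ has infinite co$+$ global dimension if and only if $\mathrm{HH}^*_\tau(\Lambda)$ is infinite; 2. $\Lambda$ has infinite $+$ global dimension if and only if $\mathrm{HH}_*^\tau(\Lambda)$ is infinite. -/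

import Mathlib

open CategoryTheory
open scoped TensorProduct

universe u

noncomputable section

/-! ### Path algebras and bound quiver algebras -/

namespace BQ

/-- The paths of a quiver `V`, with their source `p.1` and target `p.2.1`. -/
abbrev QPath (V : Type u) [Quiver.{u} V] : Type u := Σ x y : V, Quiver.Path x y

/-- The path algebra `kQ`, with basis the paths of the quiver. -/
def PathAlgebra (k V : Type u) [Field k] [Quiver.{u} V] : Type u := QPath V →₀ k

namespace PathAlgebra

variable (k : Type u) {V : Type u} [Field k] [Quiver.{u} V]

instance : AddCommGroup (PathAlgebra k V) := inferInstanceAs (AddCommGroup (QPath V →₀ k))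

instance : Module k (PathAlgebra k V) := inferInstanceAs (Module k (QPath V →₀ k))

/-- The coordinates of an element of `kQ` in the basis of paths. -/
def coeffs : PathAlgebra k V ≃ₗ[k] (QPath V →₀ k) := LinearEquiv.refl k (QPath V →₀ k)

/-- The basis element of `kQ` given by a path. -/
def ofPath (p : QPath V) : PathAlgebra k V := (coeffs k).symm (Finsupp.single p 1)

/-- The trivial path at the vertex `x`, an idempotent of `kQ`. -/
def vertex (x : V) : PathAlgebra k V := ofPath k ⟨x, x, Quiver.Path.nil⟩

/-- An arrow of the quiver as an element of `kQ`. -/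
def arrow {x y : V} (a : x ⟶ y) : PathAlgebra k V := ofPath k ⟨x, y, a.toPath⟩

open scoped Classical in
/-- The product `q p` of two paths: it is "`p` followed by `q`" if the target of `p` is the source
of `q`, and `0` otherwise. -/
def pathMul (q p : QPath V) : PathAlgebra k V :=
  if h : p.2.1 = q.1 then ofPath k ⟨p.1, q.2.1, p.2.2.comp (q.2.2.cast h.symm rfl)⟩ else 0

/-- The bilinear extension of the product of paths. -/
def mulLin : PathAlgebra k V →ₗ[k] PathAlgebra k V →ₗ[k] PathAlgebra k V :=
  (Finsupp.linearCombination k fun q : QPath V =>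
    (Finsupp.linearCombination k fun p : QPath V => pathMul k q p) ∘ₗ
      (coeffs k).toLinearMap) ∘ₗ (coeffs k).toLinearMap

instance : Mul (PathAlgebra k V) := ⟨fun f g => mulLin k f g⟩

instance [Fintype V] : One (PathAlgebra k V) := ⟨∑ x : V, vertex k x⟩

theorem mul_def (f g : PathAlgebra k V) : f * g = mulLin k f g := rfl

theorem one_def [Fintype V] : (1 : PathAlgebra k V) = ∑ x : V, vertex k x := rfl

theorem ofPath_mul_ofPath (q p : QPath V) : ofPath k q * ofPath k p = pathMul k q p := by
  simp [mul_def, mulLin, ofPath]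

theorem ofPath_comp {x y z : V} (q : Quiver.Path y z) (p : Quiver.Path x y) :
    ofPath k ⟨y, z, q⟩ * ofPath k ⟨x, y, p⟩ = ofPath k ⟨x, z, p.comp q⟩ := by
  rw [ofPath_mul_ofPath, pathMul, dif_pos rfl]; rfl

theorem ofPath_mul_of_ne {q p : QPath V} (h : p.2.1 ≠ q.1) : ofPath k q * ofPath k p = 0 := by
  rw [ofPath_mul_ofPath, pathMul, dif_neg h]

variable {k} in
@[elab_as_elim]
theorem induction {P : PathAlgebra k V → Prop} (f : PathAlgebra k V) (zero : P 0)
    (add : ∀ f g, P f → P g → P (f + g)) (smul : ∀ (c : k) p, P (c • ofPath k p)) : P f := by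
  have key : ∀ g : QPath V →₀ k, P ((coeffs k).symm g) := fun g => by
    induction g using Finsupp.induction_linear with
    | zero => simpa using zero
    | add g h hg hh => simpa using add _ _ hg hh
    | single p c =>
      have := smul c p
      rwa [ofPath, ← map_smul, Finsupp.smul_single, smul_eq_mul, mul_one] at this
  simpa using key (coeffs k f)

theorem add_mul' (f g h : PathAlgebra k V) : (f + g) * h = f * h + g * h := by
  simp [mul_def]

theorem mul_add' (f g h : PathAlgebra k V) : f * (g + h) = f * g + f * h := by
  simp [mul_def]

theorem smul_mul' (c : k) (f g : PathAlgebra k V) : (c • f) * g = c • (f * g) := by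
  simp [mul_def]

theorem mul_smul' (c : k) (f g : PathAlgebra k V) : f * (c • g) = c • (f * g) := by
  simp [mul_def]

theorem zero_mul' (f : PathAlgebra k V) : 0 * f = 0 := by simp [mul_def]

theorem mul_zero' (f : PathAlgebra k V) : f * 0 = 0 := by simp [mul_def]

theorem mul_assoc' (f g h : PathAlgebra k V) : f * g * h = f * (g * h) := by
  induction f using induction with
  | zero => simp only [zero_mul']
  | add f₁ f₂ h₁ h₂ => simp only [add_mul', h₁, h₂]
  | smul a r =>
  induction g using induction with
  | zero => simp only [zero_mul', mul_zero']
  | add f₁ f₂ h₁ h₂ => simp only [add_mul', mul_add', h₁, h₂]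
  | smul b q =>
  induction h using induction with
  | zero => simp only [mul_zero']
  | add f₁ f₂ h₁ h₂ => simp only [mul_add', h₁, h₂]
  | smul c p =>
  simp only [smul_mul', mul_smul']
  congr 3
  obtain ⟨x, y, p⟩ := p
  obtain ⟨y', z, q⟩ := q
  obtain ⟨z', w, r⟩ := r
  by_cases hy : y = y'
  · subst hy
    by_cases hz : z = z'
    · subst hz
      simp only [ofPath_comp, Quiver.Path.comp_assoc]
    · rw [ofPath_mul_of_ne k (by exact hz), ofPath_comp, ofPath_mul_of_ne k (by exact hz),
        zero_mul']
  · rw [ofPath_mul_of_ne k (q := ⟨y', z, q⟩) (p := ⟨x, y, p⟩) (by exact hy), mul_zero']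
    by_cases hz : z = z'
    · subst hz
      rw [ofPath_comp, ofPath_mul_of_ne k (by exact hy)]
    · rw [ofPath_mul_of_ne k (by exact hz), zero_mul']

theorem one_mul' [Fintype V] (f : PathAlgebra k V) : 1 * f = f := by
  classical
  induction f using induction with
  | zero => simp only [mul_zero']
  | add f₁ f₂ h₁ h₂ => simp only [mul_add', h₁, h₂]
  | smul a p =>
  obtain ⟨x, y, p⟩ := p
  rw [mul_smul', one_def, mul_def, map_sum, LinearMap.sum_apply, Finset.sum_eq_single y]
  · rw [← mul_def, vertex, ofPath_comp, Quiver.Path.comp_nil]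
  · intro z _ hz
    exact ofPath_mul_of_ne k (by exact fun h => hz h.symm)
  · simp

theorem mul_one' [Fintype V] (f : PathAlgebra k V) : f * 1 = f := by
  classical
  induction f using induction with
  | zero => simp only [zero_mul']
  | add f₁ f₂ h₁ h₂ => simp only [add_mul', h₁, h₂]
  | smul a p =>
  obtain ⟨x, y, p⟩ := p
  rw [smul_mul', one_def, mul_def, map_sum, Finset.sum_eq_single x]
  · rw [← mul_def, vertex, ofPath_comp, Quiver.Path.nil_comp]
  · intro z _ hz
    exact ofPath_mul_of_ne k (by exact hz)
  · simp

variable [Fintype V]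

instance : Ring (PathAlgebra k V) :=
  { (inferInstance : AddCommGroup (PathAlgebra k V)) with
    mul := (· * ·)
    one := 1
    left_distrib := mul_add' k
    right_distrib := add_mul' k
    zero_mul := zero_mul' k
    mul_zero := mul_zero' k
    mul_assoc := mul_assoc' k
    one_mul := one_mul' k
    mul_one := mul_one' k }

instance : Algebra k (PathAlgebra k V) := Algebra.ofModule (smul_mul' k) (fun c f g => mul_smul' k c f g)

variable (V) in
/-- The two-sided ideal `F` of `kQ` generated by the arrows. -/
def arrowIdeal : Ideal (PathAlgebra k V) :=
  (TwoSidedIdeal.span {f : PathAlgebra k V | ∃ (x y : V) (a : x ⟶ y), f = arrow k a}).asIdeal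

instance : (arrowIdeal k V).IsTwoSided := by
  unfold arrowIdeal; infer_instance

/-- The coefficient at the trivial path at `x`. -/
def vertexCoeff (x : V) : PathAlgebra k V →ₗ[k] k :=
  Finsupp.lapply (⟨x, x, Quiver.Path.nil⟩ : QPath V) ∘ₗ (coeffs k).toLinearMap

theorem vertexCoeff_ofPath_pos {x y z : V} (p : Quiver.Path y z) (hp : p.length ≠ 0) :
    vertexCoeff k x (ofPath k ⟨y, z, p⟩) = 0 := by
  classical
  simp only [vertexCoeff, ofPath, LinearMap.comp_apply, LinearEquiv.coe_coe,
    LinearEquiv.apply_symm_apply, Finsupp.lapply_apply, Finsupp.single_apply]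
  refine if_neg fun h => hp ?_
  have key : ∀ q r : QPath V, q = r → q.2.2.length = r.2.2.length := by rintro q _ rfl; rfl
  exact key _ _ h

theorem vertexCoeff_vertex_self (x : V) : vertexCoeff k x (vertex k x) = 1 := by
  simp [vertexCoeff, vertex, ofPath]

theorem vertexCoeff_vertex_of_ne {x y : V} (h : y ≠ x) : vertexCoeff k x (vertex k y) = 0 := by
  classical
  simp only [vertexCoeff, vertex, ofPath, LinearMap.comp_apply, LinearEquiv.coe_coe,
    LinearEquiv.apply_symm_apply, Finsupp.lapply_apply, Finsupp.single_apply]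
  exact if_neg fun h' => h (congrArg Sigma.fst h')

theorem vertexCoeff_one (x : V) : vertexCoeff k x 1 = 1 := by
  classical
  rw [one_def, map_sum, Finset.sum_eq_single x, vertexCoeff_vertex_self]
  · exact fun y _ hy => vertexCoeff_vertex_of_ne k hy
  · simp

theorem vertexCoeff_mul (x : V) (f g : PathAlgebra k V) :
    vertexCoeff k x (f * g) = vertexCoeff k x f * vertexCoeff k x g := by
  induction f using induction with
  | zero => simp
  | add f₁ f₂ h₁ h₂ => simp only [add_mul, map_add, h₁, h₂]
  | smul a q =>
  induction g using induction with
  | zero => simp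
  | add f₁ f₂ h₁ h₂ => simp only [mul_add, map_add, h₁, h₂]
  | smul b p =>
  rw [smul_mul', mul_smul']
  simp only [map_smul, smul_eq_mul]
  suffices vertexCoeff k x (ofPath k q * ofPath k p) =
      vertexCoeff k x (ofPath k q) * vertexCoeff k x (ofPath k p) by rw [this]; ring
  obtain ⟨y, z, p⟩ := p
  obtain ⟨y', w, q⟩ := q
  by_cases hy : z = y'
  · subst hy
    rw [ofPath_comp]
    by_cases hp : p.length = 0
    · cases p with
      | nil =>
        by_cases hx : y = x
        · subst hx
          rw [Quiver.Path.nil_comp, show vertexCoeff k y (ofPath k ⟨y, y, Quiver.Path.nil⟩) = 1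
            from vertexCoeff_vertex_self k y, mul_one]
        · rw [show vertexCoeff k x (ofPath k ⟨y, y, Quiver.Path.nil⟩) = 0 from
            vertexCoeff_vertex_of_ne k hx, mul_zero, Quiver.Path.nil_comp]
          by_cases hq : q.length = 0
          · cases q with
            | nil => exact vertexCoeff_vertex_of_ne k hx
            | cons => simp at hq
          · exact vertexCoeff_ofPath_pos k q hq
      | cons => simp at hp
    · rw [vertexCoeff_ofPath_pos k p hp, mul_zero, vertexCoeff_ofPath_pos]
      rw [Quiver.Path.length_comp]; omega
  · rw [ofPath_mul_of_ne k (by exact hy), map_zero]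
    by_cases hp : p.length = 0
    · by_cases hq : q.length = 0
      · cases p with
        | cons => simp at hp
        | nil =>
        cases q with
        | cons => simp at hq
        | nil =>
        by_cases hx : y = x
        · subst hx
          rw [show vertexCoeff k y (ofPath k ⟨y', y', Quiver.Path.nil⟩) = 0 from
            vertexCoeff_vertex_of_ne k (Ne.symm hy), zero_mul]
        · rw [show vertexCoeff k x (ofPath k ⟨y, y, Quiver.Path.nil⟩) = 0 from
            vertexCoeff_vertex_of_ne k hx, mul_zero]
      · rw [vertexCoeff_ofPath_pos k q hq, zero_mul]
    · rw [vertexCoeff_ofPath_pos k p hp, mul_zero]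

/-- The algebra map `kQ → k` taking an element to its coefficient at the trivial path at `x`. -/
def vertexChar (x : V) : PathAlgebra k V →ₐ[k] k :=
  AlgHom.ofLinearMap (vertexCoeff k x) (vertexCoeff_one k x) (vertexCoeff_mul k x)

theorem arrowIdeal_le_ker (x : V) : arrowIdeal k V ≤ RingHom.ker (vertexChar k x) := by
  have : TwoSidedIdeal.span {f : PathAlgebra k V | ∃ (x y : V) (a : x ⟶ y), f = arrow k a} ≤
      TwoSidedIdeal.ker (vertexChar k x) := by
    rw [TwoSidedIdeal.span_le]
    rintro _ ⟨y, z, a, rfl⟩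
    exact (TwoSidedIdeal.mem_ker _).2 (vertexCoeff_ofPath_pos k a.toPath (by simp))
  intro f hf
  exact (TwoSidedIdeal.mem_ker _).1 (this (TwoSidedIdeal.mem_asIdeal.1 hf))

theorem ofPath_mem_arrowIdeal_pow {x y : V} (p : Quiver.Path x y) :
    ofPath k ⟨x, y, p⟩ ∈ arrowIdeal k V ^ p.length := by
  induction p with
  | nil => simp [Submodule.pow_zero, Ideal.one_eq_top]
  | cons p a ih =>
    rw [Quiver.Path.length_cons, Ideal.IsTwoSided.pow_succ]
    have h : ofPath k ⟨x, _, p.cons a⟩ = arrow k a * ofPath k ⟨x, _, p⟩ := by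
      rw [arrow, ofPath_comp]; rfl
    rw [h]
    exact Ideal.mul_mem_mul
      (TwoSidedIdeal.mem_asIdeal.2 (TwoSidedIdeal.subset_span ⟨_, _, a, rfl⟩)) ih

end PathAlgebra

/-- The paths of a given length in a finite quiver are finitely many. -/
theorem finite_paths_length (V : Type u) [Quiver.{u} V] [Finite V]
    [∀ x y : V, Finite (x ⟶ y)] (n : ℕ) : {p : QPath V | p.2.2.length = n}.Finite := by
  induction n with
  | zero =>
    refine (Set.finite_range fun x : V => (⟨x, x, Quiver.Path.nil⟩ : QPath V)).subset ?_
    rintro ⟨x, y, p⟩ hp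
    cases p with
    | nil => exact ⟨x, rfl⟩
    | cons => simp at hp
  | succ n ih =>
    have := ih.to_subtype
    refine (Set.finite_range fun q : Σ (p : {p : QPath V | p.2.2.length = n}) (z : V),
      p.1.2.1 ⟶ z => (⟨q.1.1.1, q.2.1, q.1.1.2.2.cons q.2.2⟩ : QPath V)).subset ?_
    rintro ⟨x, y, p⟩ hp
    cases p with
    | nil => simp at hp
    | cons p a =>
      exact ⟨⟨⟨⟨x, _, p⟩, by simpa using hp⟩, y, a⟩, rfl⟩

open PathAlgebra

section BoundQuiverAlgebra

variable {k V : Type u} [Field k] [Quiver.{u} V] [Fintype V]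

/-- A two-sided ideal `I` of `kQ` is admissible if `F ^ m ⊆ I ⊆ F ^ 2` for some `m ≥ 2`, where
`F` is the ideal generated by the arrows. -/
class IsAdmissible (I : Ideal (PathAlgebra k V)) : Prop extends I.IsTwoSided where
  le_sq : I ≤ arrowIdeal k V ^ 2
  exists_pow_le : ∃ m : ℕ, 2 ≤ m ∧ arrowIdeal k V ^ m ≤ I

variable (I : Ideal (PathAlgebra k V)) [IsAdmissible I]

/-- A bound quiver algebra is finite dimensional. -/
instance [∀ x y : V, Finite (x ⟶ y)] : Module.Finite k (PathAlgebra k V ⧸ I) := by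
  obtain ⟨m, -, hm⟩ := IsAdmissible.exists_pow_le (I := I)
  have hfin : (⋃ n ∈ Finset.range m, {p : QPath V | p.2.2.length = n}).Finite :=
    Set.Finite.biUnion (Finset.finite_toSet _) fun n _ => finite_paths_length V n
  refine ⟨⟨(hfin.image fun p => Ideal.Quotient.mk I (ofPath k p)).toFinset, ?_⟩⟩
  rw [Set.Finite.coe_toFinset, eq_top_iff]
  rintro x -
  obtain ⟨f, rfl⟩ := Ideal.Quotient.mk_surjective x
  induction f using PathAlgebra.induction with
  | zero => simp
  | add f g hf hg => rw [map_add]; exact add_mem hf hg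
  | smul c p =>
    have : Ideal.Quotient.mk I (c • ofPath k p) = c • Ideal.Quotient.mk I (ofPath k p) := rfl
    rw [this]
    refine Submodule.smul_mem _ _ ?_
    by_cases hp : p.2.2.length < m
    · exact Submodule.subset_span ⟨p, by simpa using hp, rfl⟩
    · rw [Ideal.Quotient.eq_zero_iff_mem.2 (hm (Ideal.pow_le_pow_right (not_lt.1 hp)
        (ofPath_mem_arrowIdeal_pow k p.2.2)))]
      exact zero_mem _

/-- The idempotent of `kQ/I` at the vertex `x`. -/
def idem (x : V) : PathAlgebra k V ⧸ I := Ideal.Quotient.mk I (vertex k x)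

/-- The algebra map `kQ/I → k` induced by `kQ → k`, "coefficient at the trivial path at `x`". -/
def simpleChar (x : V) : (PathAlgebra k V ⧸ I) →+* k :=
  Ideal.Quotient.lift I (vertexChar k x : PathAlgebra k V →+* k) fun _ hf =>
    arrowIdeal_le_ker k x (Ideal.pow_le_self two_ne_zero (IsAdmissible.le_sq hf))

/-- The simple left `kQ/I`-module `_xk` at the vertex `x`: the space `k`, on which the trivial path
at `x` acts as the identity, and all the other paths as zero. -/
@[nolint unusedArguments]
def SimpleLeft (_I : Ideal (PathAlgebra k V)) (_x : V) : Type u := k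

instance (x : V) : AddCommGroup (SimpleLeft I x) := inferInstanceAs (AddCommGroup k)

instance (x : V) : Module (PathAlgebra k V ⧸ I) (SimpleLeft I x) :=
  Module.compHom k (simpleChar I x)

/-- The simple right `kQ/I`-module `k_x` at the vertex `x`: the space `k`, on which the trivial path
at `x` acts as the identity, and all the other paths as zero. -/
@[nolint unusedArguments]
def SimpleRight (_I : Ideal (PathAlgebra k V)) (_x : V) : Type u := k

instance (x : V) : AddCommGroup (SimpleRight I x) := inferInstanceAs (AddCommGroup k)

instance (x : V) : Module (PathAlgebra k V ⧸ I)ᵐᵒᵖ (SimpleRight I x) :=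
  Module.compHom k ((simpleChar I x).fromOpposite fun _ _ => mul_comm _ _)

end BoundQuiverAlgebra

/-! ### The functor `Tor` over a noncommutative ring -/

section Tor

variable (R : Type u) [Ring R]
variable (N : Type u) [AddCommGroup N] [Module Rᵐᵒᵖ N]

/-- The subgroup of `N ⊗[ℤ] M` generated by the elements `n r ⊗ m - n ⊗ r m`. -/
def balancedRel (M : Type u) [AddCommGroup M] [Module R M] : AddSubgroup (N ⊗[ℤ] M) :=
  AddSubgroup.closure {t | ∃ (n : N) (r : R) (m : M),
    t = (MulOpposite.op r • n) ⊗ₜ[ℤ] m - n ⊗ₜ[ℤ] (r • m)}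

/-- The tensor product `N ⊗_R M` of a right `R`-module `N` and a left `R`-module `M`. -/
abbrev BalancedTensor (M : Type u) [AddCommGroup M] [Module R M] : Type u :=
  (N ⊗[ℤ] M) ⧸ balancedRel R N M

namespace BalancedTensor

/-- The map `N ⊗_R M → N ⊗_R M'` induced by an `R`-linear map `M → M'`. -/
def map {M M' : Type u} [AddCommGroup M] [Module R M] [AddCommGroup M']
    [Module R M'] (f : M →ₗ[R] M') : BalancedTensor R N M →+ BalancedTensor R N M' :=
  QuotientAddGroup.map _ _ (LinearMap.lTensor N f.toAddMonoidHom.toIntLinearMap).toAddMonoidHom <| by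
    rw [balancedRel, AddSubgroup.closure_le]
    rintro _ ⟨n, r, m, rfl⟩
    refine AddSubgroup.subset_closure ⟨n, r, f m, ?_⟩
    rw [map_sub, LinearMap.toAddMonoidHom_coe, LinearMap.lTensor_tmul, LinearMap.lTensor_tmul]
    exact congrArg (fun t => _ - n ⊗ₜ[ℤ] t) (f.map_smul r m)

/-- The class of `n ⊗ m`. -/
def mk {M : Type u} [AddCommGroup M] [Module R M] (n : N) (m : M) :
    BalancedTensor R N M := QuotientAddGroup.mk (n ⊗ₜ[ℤ] m)

theorem hom_ext {M T : Type u} [AddCommGroup M] [Module R M] [AddCommGroup T]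
    {f g : BalancedTensor R N M →+ T} (h : ∀ n m, f (mk R N n m) = g (mk R N n m)) : f = g := by
  refine QuotientAddGroup.addMonoidHom_ext _ (AddMonoidHom.ext fun t => ?_)
  induction t using TensorProduct.induction_on with
  | zero => simp only [map_zero]
  | tmul n m => exact h n m
  | add s t hs ht => simp only [map_add, hs, ht]

theorem mk_add {M : Type u} [AddCommGroup M] [Module R M] (n : N) (m m' : M) :
    mk R N n (m + m') = mk R N n m + mk R N n m' := by
  rw [mk, TensorProduct.tmul_add]; rfl

end BalancedTensor

/-- The functor `N ⊗_R -` from left `R`-modules to abelian groups. -/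
def balancedTensorFunctor : ModuleCat.{u} R ⥤ AddCommGrpCat.{u} where
  obj M := AddCommGrpCat.of (BalancedTensor R N M)
  map f := AddCommGrpCat.ofHom (BalancedTensor.map R N f.hom)
  map_id _ := AddCommGrpCat.hom_ext (BalancedTensor.hom_ext R N fun _ _ => rfl)
  map_comp _ _ := AddCommGrpCat.hom_ext (BalancedTensor.hom_ext R N fun _ _ => rfl)

instance : (balancedTensorFunctor R N).Additive where
  map_add := AddCommGrpCat.hom_ext
    (BalancedTensor.hom_ext R N fun _ _ => BalancedTensor.mk_add R N _ _ _)

/-- `Tor_n^R(N, M)` for a right `R`-module `N` and a left `R`-module `M`: the value at `M` of the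
`n`-th left derived functor of `N ⊗_R -`. -/
def TorGroup (n : ℕ) (M : Type u) [AddCommGroup M] [Module R M] : Type u :=
  ((balancedTensorFunctor R N).leftDerived n).obj (ModuleCat.of R M)

end Tor

/-! ### Projective covers, syzygies and the Auslander-Reiten translate -/

section ProjectiveCover

variable {A : Type u} [Ring A]

/-- A projective cover: a surjection `f` from a projective module whose kernel is superfluous. -/
structure IsProjectiveCover {P M : Type u} [AddCommGroup P] [Module A P] [AddCommGroup M]
    [Module A M] (f : P →ₗ[A] M) : Prop where
  projective : Module.Projective A P
  surjective : Function.Surjective f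
  superfluous : ∀ N : Submodule A P, N ⊔ LinearMap.ker f = ⊤ → N = ⊤

/-- Over a left Artinian ring, every finitely generated left module has a projective cover. -/
theorem exists_isProjectiveCover [IsArtinianRing A] (M : FGModuleCat.{u} A) :
    ∃ (P : FGModuleCat.{u} A) (f : P →ₗ[A] M), IsProjectiveCover f := by
  obtain ⟨n, f, hf⟩ := Module.Finite.exists_fin' A M
  -- a minimal projective submodule of `A ^ n` which still surjects
  obtain ⟨N, ⟨hproj, hN⟩, hmin⟩ := IsArtinian.set_has_minimal
    {N : Submodule A (Fin n → A) | Module.Projective A N ∧ ∀ m, ∃ x : N, f x = m}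
    ⟨⊤, Module.Projective.of_equiv Submodule.topEquiv.symm, fun m => by
      obtain ⟨x, hx⟩ := hf m
      exact ⟨⟨x, trivial⟩, hx⟩⟩
  refine ⟨FGModuleCat.of A N, f ∘ₗ N.subtype, hproj, hN, fun K hK => ?_⟩
  change Submodule A N at K
  -- `K` surjects onto the module, so the surjection factors through `K`
  have hKs : Function.Surjective (f ∘ₗ N.subtype ∘ₗ K.subtype) := fun m => by
    obtain ⟨x, hx⟩ := hN m
    obtain ⟨y, hy, z, hz, hyz⟩ := Submodule.mem_sup.1 (hK ▸ Submodule.mem_top : x ∈ _ ⊔ _)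
    refine ⟨⟨y, hy⟩, ?_⟩
    have hz' : f z = 0 := hz
    rw [← hx, ← hyz, Submodule.coe_add, map_add, hz', add_zero]
    rfl
  obtain ⟨g, hg⟩ := Module.projective_lifting_property _ (f ∘ₗ N.subtype) hKs
  let h : Module.End A N := K.subtype ∘ₗ g
  have hh : ∀ i x, f (((h ^ i) x : N) : Fin n → A) = f (x : Fin n → A) := by
    intro i
    induction i with
    | zero => intro x; rfl
    | succ i ih =>
      intro x
      rw [pow_succ, Module.End.mul_apply, ih]
      exact LinearMap.congr_fun hg x
  -- Fitting decomposition
  obtain ⟨i, hi, hi1⟩ := (h.eventually_isCompl_ker_pow_range_pow.and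
    (Filter.eventually_ge_atTop 1)).exists
  have hrange : Module.Projective A (LinearMap.range (h ^ i)) :=
    Module.Projective.of_split (LinearMap.range (h ^ i)).subtype
      (Submodule.projectionOnto _ _ hi.symm) (by ext x; simp)
  let L : Submodule A (Fin n → A) := (LinearMap.range (h ^ i)).map N.subtype
  have hL : Module.Projective A L := Module.Projective.of_equiv
    (Submodule.equivMapOfInjective N.subtype N.injective_subtype (LinearMap.range (h ^ i)))
  have hLs : Function.Surjective (f ∘ₗ L.subtype) := fun m => by
    obtain ⟨x, hx⟩ := hN m
    exact ⟨⟨_, Submodule.mem_map_of_mem ⟨x, rfl⟩⟩, (hh i x).trans hx⟩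
  have hLN : L = N := by
    by_contra hne
    exact hmin L ⟨hL, hLs⟩ (lt_of_le_of_ne (Submodule.map_subtype_le _ _) hne)
  rw [eq_top_iff]
  rintro x -
  obtain ⟨y, ⟨z, rfl⟩, hy⟩ := hLN.ge x.2
  have hxz : (h ^ i) z = x := Subtype.ext hy
  obtain ⟨j, hj⟩ := Nat.exists_eq_add_of_le' hi1
  rw [← hxz, hj, pow_succ', Module.End.mul_apply]
  exact (g ((h ^ j) z)).2

variable [IsArtinianRing A]

/-- The projective module `P(M)` in a (chosen) projective cover `P(M) → M`. -/
def projCover (M : FGModuleCat.{u} A) : FGModuleCat.{u} A :=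
  (exists_isProjectiveCover M).choose

/-- The (chosen) projective cover `P(M) → M`. -/
def projCoverMap (M : FGModuleCat.{u} A) : projCover M →ₗ[A] M :=
  (exists_isProjectiveCover M).choose_spec.choose

theorem isProjectiveCover_projCoverMap (M : FGModuleCat.{u} A) :
    IsProjectiveCover (projCoverMap M) :=
  (exists_isProjectiveCover M).choose_spec.choose_spec

/-- The syzygy `Ω M`, the kernel of the projective cover `P(M) → M`. -/
def syzygy (M : FGModuleCat.{u} A) : FGModuleCat.{u} A :=
  FGModuleCat.of A (LinearMap.ker (projCoverMap M))

/-- The map `d : P(Ω M) → P(M)` in the minimal projective presentation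
`P(Ω M) → P(M) → M → 0` of `M`. -/
def presentationMap (M : FGModuleCat.{u} A) : projCover (syzygy M) →ₗ[A] projCover M :=
  (LinearMap.ker (projCoverMap M)).subtype ∘ₗ projCoverMap (syzygy M)

/-- The map of right `A`-modules `Hom_A(P', A) → Hom_A(P, A)` given by precomposition with
`d : P → P'`. -/
def homDual {P P' : Type u} [AddCommGroup P] [Module A P] [AddCommGroup P'] [Module A P']
    (d : P →ₗ[A] P') : (P' →ₗ[A] A) →ₗ[Aᵐᵒᵖ] (P →ₗ[A] A) where
  toFun φ := φ ∘ₗ d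
  map_add' _ _ := rfl
  map_smul' _ _ := rfl

/-- The transpose `Tr M`, a right `A`-module: the cokernel of `Hom_A(P(M), A) → Hom_A(P(Ω M), A)`,
for the minimal projective presentation `P(Ω M) → P(M) → M → 0`. -/
abbrev Transpose (M : FGModuleCat.{u} A) : Type u :=
  (projCover (syzygy M) →ₗ[A] A) ⧸ LinearMap.range (homDual (presentationMap M))

end ProjectiveCover

section Dual

variable (k : Type u) [Field k]

/-- The dual vector space `D N = Hom_k(N, k)`. -/
def KDual (N : Type u) [AddCommGroup N] [Module k N] : Type u := N →ₗ[k] k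

variable (N : Type u) [AddCommGroup N] [Module k N]

instance : AddCommGroup (KDual k N) := inferInstanceAs (AddCommGroup (N →ₗ[k] k))

instance : Module k (KDual k N) := inferInstanceAs (Module k (N →ₗ[k] k))

variable (A : Type u) [Ring A] [Algebra k A]

/-- The dual of a right `A`-module `N` is a left `A`-module, by `(a • f) n = f (n a)`. -/
instance (priority := low) KDual.instLeft [Module Aᵐᵒᵖ N] [IsScalarTower k Aᵐᵒᵖ N] :
    Module A (KDual k N) :=
  Module.compHom (N →ₗ[k] k)
    ({ toFun := fun a => LinearMap.lcomp k k (Algebra.lsmul k k N (MulOpposite.op a))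
       map_one' := by ext f n; simp
       map_mul' := fun _ _ => by ext f n; simp
       map_zero' := by ext f n; simp
       map_add' := fun _ _ => by ext f n; simp } : A →+* Module.End k (N →ₗ[k] k))

/-- The dual of a left `A`-module `N` is a right `A`-module, by `(f • a) n = f (a n)`. -/
instance (priority := low) KDual.instRight [Module A N] [IsScalarTower k A N] :
    Module Aᵐᵒᵖ (KDual k N) :=
  Module.compHom (N →ₗ[k] k)
    ({ toFun := fun a => LinearMap.lcomp k k (Algebra.lsmul k k N a.unop)
       map_one' := by ext f n; simp
       map_mul' := fun _ _ => by ext f n; simp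
       map_zero' := by ext f n; simp
       map_add' := fun _ _ => by ext f n; simp } : Aᵐᵒᵖ →+* Module.End k (N →ₗ[k] k))

variable {k N A} in
theorem KDual.op_smul_apply [Module Aᵐᵒᵖ N] [IsScalarTower k Aᵐᵒᵖ N] (a : A) (f : KDual k N)
    (n : N) : (show N →ₗ[k] k from a • f) n = (show N →ₗ[k] k from f) (MulOpposite.op a • n) := rfl

variable {k N A} in
theorem KDual.smul_apply [Module A N] [IsScalarTower k A N] (a : A) (f : KDual k N)
    (n : N) : (show N →ₗ[k] k from MulOpposite.op a • f) n = (show N →ₗ[k] k from f) (a • n) := rfl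

instance [Module Aᵐᵒᵖ N] [IsScalarTower k Aᵐᵒᵖ N] : IsScalarTower k A (KDual k N) :=
  IsScalarTower.of_algebraMap_smul fun c f => LinearMap.ext fun n => by
    have : (MulOpposite.op (algebraMap k A c)) • n = c • n := by
      rw [← MulOpposite.algebraMap_apply, algebraMap_smul]
    exact (congrArg (show N →ₗ[k] k from f) this).trans ((show N →ₗ[k] k from f).map_smul c n)

instance [Module A N] [IsScalarTower k A N] : IsScalarTower k Aᵐᵒᵖ (KDual k N) :=
  IsScalarTower.of_algebraMap_smul fun c f => LinearMap.ext fun n => by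
    have : (algebraMap k A c) • n = c • n := algebraMap_smul A c n
    exact (congrArg (show N →ₗ[k] k from f) this).trans ((show N →ₗ[k] k from f).map_smul c n)

/-- The dual of a bimodule is a bimodule. -/
instance [Module A N] [IsScalarTower k A N] [Module Aᵐᵒᵖ N] [IsScalarTower k Aᵐᵒᵖ N]
    [SMulCommClass A Aᵐᵒᵖ N] : SMulCommClass A Aᵐᵒᵖ (KDual k N) :=
  ⟨fun a b f => LinearMap.ext fun n =>
    congrArg (show N →ₗ[k] k from f) (smul_comm b.unop (MulOpposite.op a) n)⟩

end Dual

section Tau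

variable (k : Type u) [Field k] (A : Type u) [Ring A] [Algebra k A] [IsArtinianRing A]

/-- The Auslander-Reiten translate `τ M = D Tr M`, a left `A`-module. -/
abbrev ARTranslate (M : FGModuleCat.{u} A) : Type u := KDual k (Transpose M)

/-- The `n`-Auslander-Reiten translate `τ_n M = τ Ω^{n-1} M`, for `n ≥ 1`. -/
abbrev nARTranslate (n : ℕ+) (M : FGModuleCat.{u} A) : Type u :=
  ARTranslate k A (syzygy^[(n : ℕ) - 1] M)

end Tau

/-! ### `τ`-Hochschild cohomology and homology -/

section Hochschild

variable (k : Type u) [Field k] (Λ : Type u) [Ring Λ] [Algebra k Λ]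

/-- The enveloping algebra of `Λ`, whose left modules are the `Λ`-bimodules. -/
abbrev Env : Type u := Λ ⊗[k] Λᵐᵒᵖ

/-- A `Λ`-bimodule `X` regarded as a left module over the enveloping algebra, where `a ⊗ b` acts
by `x ↦ a x b`. -/
def Bimod (X : Type u) : Type u := X

section Bimod

variable (X : Type u) [AddCommGroup X]

instance : AddCommGroup (Bimod X) := inferInstanceAs (AddCommGroup X)

variable [Module k X] [Module Λ X] [IsScalarTower k Λ X] [Module Λᵐᵒᵖ X] [IsScalarTower k Λᵐᵒᵖ X]
  [SMulCommClass Λ Λᵐᵒᵖ X]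

instance : Module (Env k Λ) (Bimod X) :=
  letI : Module (Env k Λ) X := TensorProduct.Algebra.module
  inferInstanceAs (Module (Env k Λ) X)

variable {X} in
/-- The identity map `X → X`. -/
def Bimod.of : X ≃+ Bimod X := AddEquiv.refl X

variable {k Λ X} in
theorem Bimod.tmul_smul (a : Λ) (b : Λᵐᵒᵖ) (x : X) :
    (a ⊗ₜ[k] b) • Bimod.of x = Bimod.of (a • b • x) :=
  rfl

end Bimod

variable [Module.Finite k Λ]

instance : IsArtinianRing (Env k Λ) := IsArtinianRing.of_finite k _

/-- `Λ` as a bimodule over itself is finitely generated. -/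
instance : Module.Finite (Env k Λ) (Bimod Λ) := by
  refine ⟨⟨{Bimod.of 1}, eq_top_iff.2 fun x _ => ?_⟩⟩
  obtain ⟨x, rfl⟩ := Bimod.of.surjective x
  have h : (x ⊗ₜ[k] 1 : Env k Λ) • Bimod.of (1 : Λ) = Bimod.of x := by
    rw [Bimod.tmul_smul, one_smul, smul_eq_mul, mul_one]
  rw [← h]
  exact Submodule.smul_mem _ _ (Submodule.subset_span (by simp))

/-- The bimodule `τ_n Λ`, for `n ≥ 1`. -/
abbrev tauBimod (n : ℕ+) : Type u :=
  nARTranslate k (Env k Λ) n (FGModuleCat.of (Env k Λ) (Bimod Λ))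

variable (X : Type u) [AddCommGroup X] [Module k X] [Module Λ X] [IsScalarTower k Λ X]
  [Module Λᵐᵒᵖ X] [IsScalarTower k Λᵐᵒᵖ X] [SMulCommClass Λ Λᵐᵒᵖ X]

/-- The `τ`-Hochschild cohomology `D Hom(X, τ_n Λ)` in degree `n ≥ 1`, with coefficients in the
bimodule `X`. -/
def TauHHCohomology (n : ℕ+) : Type u := KDual k (Bimod X →ₗ[Env k Λ] tauBimod k Λ n)

/-- The `τ`-Hochschild homology `Hom(D X, τ_n Λ)` in degree `n ≥ 1`, with coefficients in the
bimodule `X`. -/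
def TauHHHomology (n : ℕ+) : Type u := Bimod (KDual k X) →ₗ[Env k Λ] tauBimod k Λ n

end Hochschild

/-- A graded vector space is infinite if it is nonzero in infinitely many degrees. -/
def IsInfiniteGraded {ι : Type} (W : ι → Type u) : Prop := {n : ι | Nontrivial (W n)}.Infinite

section GlobalDimension

variable {k V : Type u} [Field k] [Quiver.{u} V] [Fintype V]
  (I : Ideal (PathAlgebra k V)) [IsAdmissible I]

/-- `kQ/I` has infinite `+` global dimension: for some vertices `y`, `x` one has `y Λ x ≠ 0` and
`Tor_*^Λ(k_x, _yk)` is infinite. -/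
def HasInfinitePlusGlobalDimension : Prop :=
  ∃ y x : V, (∃ a : PathAlgebra k V ⧸ I, idem I y * a * idem I x ≠ 0) ∧
    IsInfiniteGraded fun n : ℕ =>
      TorGroup (PathAlgebra k V ⧸ I) (SimpleRight I x) n (SimpleLeft I y)

/-- `kQ/I` has infinite `co+` global dimension: for some vertices `y`, `x` one has `y Λ x ≠ 0` and
`Tor_*^Λ(k_y, _xk)` is infinite. -/
def HasInfiniteCoPlusGlobalDimension : Prop :=
  ∃ y x : V, (∃ a : PathAlgebra k V ⧸ I, idem I y * a * idem I x ≠ 0) ∧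
    IsInfiniteGraded fun n : ℕ =>
      TorGroup (PathAlgebra k V ⧸ I) (SimpleRight I y) n (SimpleLeft I x)

end GlobalDimension

end BQ

end

namespace BQ

/-! Let `P_*` be the minimal projective bimodule resolution of `Λ`, and let `X` be a bimodule. Since
`Hom(X, D Tr M)` is the dual of `Tr M ⊗ X`, and `Tr M ⊗ X` is the cokernel of `Hom(P(M), X) →
Hom(P(ΩM), X)`, the space `Hom(X, τ_n Λ)` vanishes exactly when `Hom(P_{n-1}, X) → Hom(P_n, X)` is
onto (`nontrivial_hom_ARTranslate_iff`). Two consecutive maps of this complex compose to zero, so if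
both are onto then the last term vanishes. Hence `Hom(X, τ_n Λ)` is nonzero infinitely often if and
only if `Hom(P_n, X)` is (`infinite_hom_nARTranslate_iff`).

The algebra `Λᵉ` is split basic, with simple modules indexed by pairs of vertices. So `Hom(P_n, X) ≠
0` means that for some pair `(y, x)` the simple bimodule at `(y, x)` lies in the top of `P_n` and
`yXx ≠ 0` (`IsBasicSplit.nontrivial_hom_iff`).

The top of `P_n` is measured by `Tor`. The resolution `P_* → Λ` splits as a complex of right
modules, so `P_* ⊗_Λ _xk` is a projective resolution of `_xk`. Minimality of `P_*` makes all
differentials vanish after applying `k_y ⊗_Λ -`. Hence `Tor_n(k_y, _xk) ≠ 0` if and only if the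
simple at `(y, x)` occurs in the top of `P_n` (`nontrivial_TorGroup_simple_iff`).

There are finitely many pairs, so one of them accounts for infinitely many degrees. Taking `X = Λ`
gives the condition `yΛx ≠ 0`. Taking `X = DΛ` gives `xΛy ≠ 0`, because duality exchanges the two
sides; this is the difference between co+ and +. -/

theorem exists_dualBasis (A P : Type*) [Ring A] [AddCommGroup P] [Module A P] [Module.Finite A P]
    [Module.Projective A P] :
    ∃ (n : ℕ) (p : Fin n → P) (g : Fin n → (P →ₗ[A] A)), ∀ x, ∑ j, g j x • p j = x := by
  obtain ⟨n, f, g, -, -, hfg⟩ := Module.Finite.exists_comp_eq_id_of_projective A P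
  refine ⟨n, fun j => f (Pi.single j 1), fun j => LinearMap.proj j ∘ₗ g, fun x => ?_⟩
  conv_rhs => rw [← LinearMap.id_apply (R := A) x, ← hfg, LinearMap.comp_apply,
    ← Finset.univ_sum_single (g x), map_sum]
  refine Finset.sum_congr rfl fun j _ => ?_
  rw [← map_smul, ← Pi.single_smul, smul_eq_mul, mul_one]
  rfl

theorem nontrivial_KDual_iff (k : Type u) [Field k] (N : Type u) [AddCommGroup N] [Module k N] :
    Nontrivial (KDual k N) ↔ Nontrivial N :=
  Module.nontrivial_dual_iff (K := k) (V := N)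

/-! ### Homomorphisms into Auslander-Reiten translates of syzygies -/

section Homs

variable {k : Type u} [Field k] {A : Type u} [Ring A] [Algebra k A]

section Translate

variable [IsArtinianRing A]

instance projective_projCover (M : FGModuleCat.{u} A) : Module.Projective A (projCover M) :=
  (isProjectiveCover_projCoverMap M).projective

theorem presentationMap_comp_presentationMap (M : FGModuleCat.{u} A) :
    presentationMap M ∘ₗ presentationMap (syzygy M) = 0 := by
  refine LinearMap.ext fun x => ?_
  have h : projCoverMap (syzygy M) (presentationMap (syzygy M) x) = 0 :=
    (projCoverMap (syzygy (syzygy M)) x).2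
  exact congrArg (LinearMap.ker (projCoverMap M)).subtype h

variable (k) in
/-- `Hom(X, D Tr M)` vanishes exactly if each map `P(Ω M) → X` extends along `P(Ω M) → P(M)`. -/
theorem nontrivial_hom_ARTranslate_iff (M : FGModuleCat.{u} A) (X : Type u) [AddCommGroup X]
    [Module A X] :
    Nontrivial (X →ₗ[A] ARTranslate k A M) ↔
      ∃ f : projCover (syzygy M) →ₗ[A] X, ∀ h : projCover M →ₗ[A] X,
        h ∘ₗ presentationMap M ≠ f := by
  let _ : Module k X := Module.compHom X (algebraMap k A)
  have : IsScalarTower k A X := IsScalarTower.of_algebraMap_smul fun _ _ => rfl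
  have : SMulCommClass A k X := IsScalarTower.to_smulCommClass'
  obtain ⟨m, p, g, hg⟩ := exists_dualBasis A (projCover (syzygy M))
  obtain ⟨r, q, h, hh⟩ := exists_dualBasis A (projCover M)
  set d := presentationMap M
  -- `ev g x` is the image of `g ⊗ x` under the canonical map `Hom(P, A) ⊗ X → Hom(P, X)`, which is
  -- bijective for finitely generated projective `P`.
  let ev : ∀ {P : Type u} [AddCommGroup P] [Module A P], (P →ₗ[A] A) → X → (P →ₗ[A] X) :=
    fun g x => (LinearMap.toSpanSingleton A X x) ∘ₗ g
  let comp : (projCover M →ₗ[A] X) →ₗ[k] (projCover (syzygy M) →ₗ[A] X) :=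
    { toFun := fun f => f ∘ₗ d, map_add' := fun _ _ => rfl, map_smul' := fun _ _ => rfl }
  constructor
  · intro hne
    obtain ⟨B, hB⟩ := exists_ne (0 : X →ₗ[A] ARTranslate k A M)
    by_contra! hsurj
    refine hB (LinearMap.ext fun x => LinearMap.ext fun t => ?_)
    obtain ⟨φ, rfl⟩ := Submodule.Quotient.mk_surjective _ t
    let c : X → (Transpose M →ₗ[k] k) := fun x => B x
    -- The map `B` is viewed as a balanced pairing of `Hom(P(ΩM), A)` with `X` that kills everything
    -- factoring through `d`.
    let b : (projCover (syzygy M) →ₗ[A] A) → X → k := fun φ x => c x (Submodule.Quotient.mk φ)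
    have badd : ∀ φ ψ x, b (φ + ψ) x = b φ x + b ψ x := fun φ ψ x =>
      (c x).map_add (Submodule.Quotient.mk φ) (Submodule.Quotient.mk ψ)
    have baddr : ∀ φ x y, b φ (x + y) = b φ x + b φ y := fun φ x y => by
      simp only [b, c, map_add]; rfl
    have bsmul : ∀ φ (a : A) x, b φ (a • x) = b (MulOpposite.op a • φ) x := fun φ a x => by
      simp only [b, c, map_smul]; rfl
    have bzero : ∀ (ψ : projCover M →ₗ[A] A) x, b (ψ ∘ₗ d) x = 0 := fun ψ x => by
      have : (Submodule.Quotient.mk (ψ ∘ₗ d) : Transpose M) = 0 :=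
        (Submodule.Quotient.mk_eq_zero _).2 ⟨ψ, rfl⟩
      exact (congrArg (c x) this).trans (c x).map_zero
    have bsum : ∀ {ι : Type} (s : Finset ι) (φ : ι → _) x,
        b (∑ i ∈ s, φ i) x = ∑ i ∈ s, b (φ i) x := fun s φ x =>
      map_sum (AddMonoidHom.mk' (fun φ => b φ x) fun φ ψ => badd φ ψ x) φ s
    -- If `ψ` extends `ev φ x`, dual bases rewrite `φ ⊗ x` as `∑ (h j ∘ d) ⊗ ψ (q j)`, and `b`
    -- annihilates each term.
    obtain ⟨ψ, hψ⟩ := hsurj (ev φ x)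
    have e1 : φ = ∑ i, MulOpposite.op (φ (p i)) • g i := LinearMap.ext fun z => by
      conv_lhs => rw [← hg z, map_sum]
      rw [LinearMap.sum_apply]
      exact Finset.sum_congr rfl fun i _ => by rw [map_smul]; rfl
    have e2 : ∀ i, φ (p i) • x = ∑ j, h j (d (p i)) • ψ (q j) := fun i => by
      have := LinearMap.congr_fun hψ (p i)
      rw [show φ (p i) • x = ev φ x (p i) from rfl, ← this, LinearMap.comp_apply]
      conv_lhs => rw [← hh (d (p i)), map_sum]
      simp only [map_smul]
    have e3 : ∀ j, h j ∘ₗ d = ∑ i, MulOpposite.op (h j (d (p i))) • g i := fun j =>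
      LinearMap.ext fun z => by
        conv_lhs => rw [← hg z, map_sum]
        rw [LinearMap.sum_apply]
        exact Finset.sum_congr rfl fun i _ => by rw [map_smul]; rfl
    have baddr' : ∀ φ {ι : Type} (s : Finset ι) (x : ι → X),
        b φ (∑ i ∈ s, x i) = ∑ i ∈ s, b φ (x i) := fun φ _ s x =>
      map_sum (AddMonoidHom.mk' (fun x => b φ x) fun x y => baddr φ x y) x s
    change b φ x = 0
    rw [e1, bsum]
    simp only [← bsmul, e2, baddr']
    rw [Finset.sum_comm]
    refine Finset.sum_eq_zero fun j _ => ?_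
    simp only [bsmul]
    rw [← bsum, ← e3, bzero]
  · rintro ⟨f, hf⟩
    -- A functional `l` that kills the extendable maps but not `f` yields the pairing `(φ, x) ↦ l
    -- (ev φ x)`, hence a map `X → D Tr M`. It is nonzero because `f` is a sum of maps of the form
    -- `ev (g i) (f (p i))`.
    obtain ⟨l, hl, hl0⟩ := Submodule.exists_dual_map_eq_bot_of_notMem
      (p := LinearMap.range comp) (x := f) (by rintro ⟨ψ, hψ⟩; exact hf ψ hψ) inferInstance
    have hl1 : ∀ ψ, l (ψ ∘ₗ d) = 0 := fun ψ => by
      have : l (comp ψ) ∈ (LinearMap.range comp).map l := ⟨_, ⟨ψ, rfl⟩, rfl⟩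
      rwa [hl0, Submodule.mem_bot] at this
    have evadd : ∀ (φ ψ : projCover (syzygy M) →ₗ[A] A) x, ev (φ + ψ) x = ev φ x + ev ψ x :=
      fun φ ψ x => LinearMap.ext fun z => add_smul _ _ _
    have evaddr : ∀ (φ : projCover (syzygy M) →ₗ[A] A) x y, ev φ (x + y) = ev φ x + ev φ y :=
      fun φ x y => LinearMap.ext fun z => smul_add _ _ _
    have evsmul : ∀ (c : k) (φ : projCover (syzygy M) →ₗ[A] A) x, ev (c • φ) x = c • ev φ x :=
      fun c φ x => LinearMap.ext fun z => smul_assoc c (φ z) x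
    have evop : ∀ (a : A) (φ : projCover (syzygy M) →ₗ[A] A) x,
        ev (MulOpposite.op a • φ) x = ev φ (a • x) :=
      fun a φ x => LinearMap.ext fun z => mul_smul (φ z) a x
    let b : X → (Transpose M →ₗ[k] k) := fun x =>
      { toFun := fun t => Quotient.liftOn' t (fun φ => l (ev φ x)) (by
          intro φ ψ h
          obtain ⟨ξ, hξ⟩ := (Submodule.quotientRel_def _).1 h
          have : ev (φ - ψ) x = ev ξ x ∘ₗ d := by rw [← hξ]; rfl
          have h2 := evadd (φ - ψ) ψ x
          rw [sub_add_cancel] at h2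
          change l (ev φ x) = l (ev ψ x)
          rw [h2, map_add, this, hl1, zero_add])
        map_add' := by
          intro s t
          obtain ⟨φ, rfl⟩ := Submodule.Quotient.mk_surjective _ s
          obtain ⟨ψ, rfl⟩ := Submodule.Quotient.mk_surjective _ t
          exact (congrArg l (evadd φ ψ x)).trans (map_add l _ _)
        map_smul' := by
          intro c s
          obtain ⟨φ, rfl⟩ := Submodule.Quotient.mk_surjective _ s
          exact (congrArg l (evsmul c φ x)).trans (map_smul l _ _) }
    let B : X →ₗ[A] ARTranslate k A M :=
      { toFun := b
        map_add' := fun x y => LinearMap.ext fun t => by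
          obtain ⟨φ, rfl⟩ := Submodule.Quotient.mk_surjective _ t
          exact (congrArg l (evaddr φ x y)).trans (map_add l _ _)
        map_smul' := fun a x => LinearMap.ext fun t => by
          obtain ⟨φ, rfl⟩ := Submodule.Quotient.mk_surjective _ t
          exact congrArg l (evop a φ x).symm }
    refine ⟨B, 0, fun hB => hl ?_⟩
    have hB' : ∀ φ x, l (ev φ x) = 0 := fun φ x =>
      LinearMap.congr_fun (show b x = 0 from LinearMap.congr_fun hB x) (Submodule.Quotient.mk φ)
    have : f = ∑ i, ev (g i) (f (p i)) := LinearMap.ext fun z => by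
      conv_lhs => rw [← hg z, map_sum]
      rw [LinearMap.sum_apply]
      exact Finset.sum_congr rfl fun i _ => by rw [map_smul]; rfl
    rw [this, map_sum]
    exact Finset.sum_eq_zero fun i _ => hB' _ _

/-- The iterated syzygies of `M`. -/
noncomputable def iterSyzygy (M : FGModuleCat.{u} A) : ℕ → FGModuleCat.{u} A
  | 0 => M
  | n + 1 => syzygy (iterSyzygy M n)

theorem iterSyzygy_eq (M : FGModuleCat.{u} A) (n : ℕ) : iterSyzygy M n = syzygy^[n] M := by
  induction n with
  | zero => rfl
  | succ n ih => rw [Function.iterate_succ_apply', ← ih]; rfl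

variable (k) in
-- A nonzero `Hom(X, τ_n M)` forces `Hom(P_n, X) ≠ 0`. Conversely, if it vanishes in degrees `n - 1`
-- and `n`, then each `P_n → X` extends along two consecutive differentials, whose composite is
-- zero, so `Hom(P_n, X) = 0`. Only infinitude transfers, not the individual degrees.
theorem infinite_hom_nARTranslate_iff (M : FGModuleCat.{u} A) (X : Type u) [AddCommGroup X]
    [Module A X] :
    {n : ℕ+ | Nontrivial (X →ₗ[A] nARTranslate k A n M)}.Infinite ↔
      {n : ℕ | Nontrivial (projCover (iterSyzygy M n) →ₗ[A] X)}.Infinite := by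
  have key : ∀ n : ℕ+, Nontrivial (X →ₗ[A] nARTranslate k A n M) ↔
      ∃ f : projCover (iterSyzygy M ((n : ℕ) - 1 + 1)) →ₗ[A] X,
        ∀ h : projCover (iterSyzygy M ((n : ℕ) - 1)) →ₗ[A] X,
        h ∘ₗ presentationMap (iterSyzygy M ((n : ℕ) - 1)) ≠ f := fun n => by
    unfold nARTranslate
    rw [← iterSyzygy_eq]
    exact nontrivial_hom_ARTranslate_iff k _ X
  constructor <;> intro H
  · refine Set.infinite_of_forall_exists_gt fun a => ?_
    obtain ⟨n, hn, han⟩ := H.exists_gt a.succPNat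
    obtain ⟨f, hf⟩ := (key n).1 hn
    -- A map that does not extend is nonzero, since the zero map extends by zero.
    refine ⟨(n : ℕ) - 1 + 1, ⟨f, 0, fun h => hf 0 (h ▸ LinearMap.zero_comp _)⟩, ?_⟩
    have : a + 1 < n := han
    omega
  · refine Set.infinite_of_forall_exists_gt fun a => ?_
    -- The extra one ensures that with `n = m + 2` both degrees `m + 1` and `m + 2` lie beyond `a`.
    obtain ⟨n, hn, han⟩ := H.exists_gt ((a : ℕ) + 1)
    obtain ⟨m, rfl⟩ := Nat.exists_eq_add_of_le' (show 2 ≤ n by have := a.2; omega)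
    by_contra! hall
    have h1 := hall m.succPNat
    have h2 := hall (m + 1).succPNat
    rw [Set.mem_ofPred_eq, key] at h1 h2
    replace h1 := mt h1 (not_le.2 (show (a : ℕ) < m + 1 by omega))
    replace h2 := mt h2 (not_le.2 (show (a : ℕ) < m + 1 + 1 by omega))
    push Not at h1 h2
    have : Nontrivial (projCover (iterSyzygy M (m + 2)) →ₗ[A] X) := hn
    obtain ⟨f, hf⟩ := exists_ne (0 : projCover (iterSyzygy M (m + 2)) →ₗ[A] X)
    obtain ⟨g, hg⟩ := h2 f
    obtain ⟨h, hh⟩ := h1 g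
    refine hf ?_
    rw [← hg, ← hh]
    refine LinearMap.ext fun x => ?_
    exact (congrArg h (LinearMap.congr_fun
      (presentationMap_comp_presentationMap (iterSyzygy M m)) x)).trans (map_zero h)

end Translate

/-! ### Tops of projective modules over split basic algebras -/

/-- The kernel of a nonzero `φ` has codimension one. If `φ p ≠ 0` for some `p` in the kernel of the
cover, the two kernels span `P`, contradicting superfluity. This is where minimality of the
resolution enters. -/
theorem IsProjectiveCover.semilinear_eq_zero {P M : Type u} [AddCommGroup P] [Module A P]
    [AddCommGroup M] [Module A M] {f : P →ₗ[A] M} (hf : IsProjectiveCover f) (χ : A →ₐ[k] k)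
    (φ : P →ₛₗ[(χ : A →+* k)] k) {p : P} (hp : f p = 0) : φ p = 0 := by
  by_contra hne
  have htop : LinearMap.ker φ ⊔ LinearMap.ker f = ⊤ := by
    refine eq_top_iff.2 fun x _ => Submodule.mem_sup.2
      ⟨x - algebraMap k A (φ x / φ p) • p, ?_, algebraMap k A (φ x / φ p) • p,
        Submodule.smul_mem _ _ hp, sub_add_cancel _ _⟩
    rw [LinearMap.mem_ker, map_sub, map_smulₛₗ]
    simp [div_mul_cancel₀ _ hne]
  exact hne (hf.superfluous _ htop ▸ Submodule.mem_top : p ∈ LinearMap.ker φ)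

/-- A system of idempotents `e i` with sum one and of dual characters `χ i` which exhibits an
algebra as split basic: the intersection of the kernels of the characters is nilpotent. -/
structure IsBasicSplit {ι : Type*} [Fintype ι] [DecidableEq ι] (e : ι → A) (χ : ι → A →ₐ[k] k) :
    Prop where
  sum_eq_one : ∑ i, e i = 1
  idem : ∀ i, e i * e i = e i
  char_idem : ∀ i j, χ i (e j) = if i = j then 1 else 0
  nilpotent : ∃ s : ℕ, (⨅ i, RingHom.ker (χ i) : Ideal A) ^ s = ⊥

namespace IsBasicSplit

variable {ι : Type*} [Fintype ι] [DecidableEq ι] {e : ι → A} {χ : ι → A →ₐ[k] k}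

/-- A nonzero map from a finitely generated projective module `P` to `X` exists exactly if some
simple module is a quotient of `P` and a composition factor of `X`. -/
theorem nontrivial_hom_iff (h : IsBasicSplit e χ) (P X : Type u) [AddCommGroup P] [Module A P]
    [Module.Finite A P] [Module.Projective A P] [AddCommGroup X] [Module A X] :
    Nontrivial (P →ₗ[A] X) ↔
      ∃ i, (∃ x : X, e i • x ≠ 0) ∧ ∃ φ : P →ₛₗ[(χ i : A →+* k)] k, φ ≠ 0 := by
  let _ : Module k X := Module.compHom X (algebraMap k A)
  have : IsScalarTower k A X := IsScalarTower.of_algebraMap_smul fun _ _ => rfl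
  obtain ⟨s, hs⟩ := h.nilpotent
  set J : Ideal A := ⨅ i, RingHom.ker (χ i) with hJ
  have memJ : ∀ a, a ∈ J ↔ ∀ i, χ i a = 0 := fun a => by
    simp only [hJ, Submodule.mem_iInf, RingHom.mem_ker]
  constructor
  · intro hne
    obtain ⟨f, hf⟩ := exists_ne (0 : P →ₗ[A] X)
    set N := LinearMap.range f
    -- Nakayama for the nilpotent ideal `J`: the image `N` of `f` is nonzero, so `N / JN` is nonzero
    -- and some `e i` acts nontrivially on it.
    have hN : J • N ≠ N := fun hN => by
      have : ∀ t : ℕ, J ^ t • N = N := fun t => by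
        induction t with
        | zero => rw [Submodule.pow_zero, Ideal.one_eq_top, Submodule.top_smul]
        | succ t ih => rw [Submodule.pow_succ, ← Ideal.smul_eq_mul, Submodule.smul_assoc, hN, ih]
      have h0 := this s
      rw [hs, Submodule.bot_smul] at h0
      exact hf (LinearMap.range_eq_bot.1 h0.symm)
    obtain ⟨v, hv, hvJ⟩ := SetLike.exists_of_lt (lt_of_le_of_ne Submodule.smul_le_right hN)
    obtain ⟨p, rfl⟩ := hv
    obtain ⟨i, hi⟩ : ∃ i, e i • f p ∉ J • N := by
      by_contra! hall
      refine hvJ ?_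
      rw [← one_smul A (f p), ← h.sum_eq_one, Finset.sum_smul]
      exact sum_mem fun i _ => hall i
    obtain ⟨l, hl, hl0⟩ := Submodule.exists_dual_map_eq_bot_of_notMem
      (p := (J • N).restrictScalars k) hi inferInstance
    have hl1 : ∀ x ∈ J • N, l x = 0 := fun x hx => by
      have : l x ∈ ((J • N).restrictScalars k).map l := ⟨x, hx, rfl⟩
      rwa [hl0, Submodule.mem_bot] at this
    refine ⟨i, ⟨f p, fun h0 => hi (h0 ▸ zero_mem _)⟩,
      { toFun := fun p => l (e i • f p)
        map_add' := fun p q => by rw [map_add, smul_add, map_add]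
        map_smul' := fun a p => ?_ }, fun h0 => hl (LinearMap.congr_fun h0 p)⟩
    -- All characters vanish on `e i * a - χ i a • e i`, so modulo `JN` the functional `p ↦ l (e i •
    -- f p)` is semilinear for `χ i`.
    have hmem : (e i * a - χ i a • e i) • f p ∈ J • N := by
      refine Submodule.smul_mem_smul ((memJ _).2 fun j => ?_) ⟨p, rfl⟩
      rw [map_sub, map_mul, map_smul, h.char_idem]
      split_ifs with hij
      · subst hij; simp
      · simp
    have := hl1 _ hmem
    rw [sub_smul, map_sub, sub_eq_zero, mul_smul, smul_assoc] at this
    rw [f.map_smul, this]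
    exact l.map_smul _ _
  · rintro ⟨i, ⟨x, hx⟩, φ, hφ⟩
    obtain ⟨n, q, g, hg⟩ := exists_dualBasis A P
    obtain ⟨j, p, hp⟩ : ∃ j p, χ i (g j p) ≠ 0 := by
      by_contra! hall
      refine hφ (LinearMap.ext fun p => ?_)
      rw [← hg p, map_sum]
      refine Finset.sum_eq_zero fun j _ => ?_
      rw [map_smulₛₗ]
      exact (congrArg (· • φ (q j)) (hall j p)).trans (zero_smul _ _)
    refine ⟨LinearMap.toSpanSingleton A X (e i • x) ∘ₗ g j, 0, fun h0 => hx ?_⟩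
    set a := e i * g j p * e i
    have ha : a • e i • x = 0 := by
      have := LinearMap.congr_fun h0 (e i • p)
      rw [LinearMap.comp_apply, map_smul, LinearMap.toSpanSingleton_apply] at this
      rw [← mul_smul, mul_assoc, h.idem, mul_smul]
      exact this
    set c := χ i (g j p)
    -- If the constructed map were zero, `a` would kill `e i • x`, so `r` would fix it. But `r` lies
    -- in the nilpotent ideal `J`.
    set r := e i - c⁻¹ • a with hr
    have hrJ : r ∈ J := (memJ _).2 fun l => by
      rw [hr, map_sub, map_smul, map_mul, map_mul, h.char_idem]
      split_ifs with hli
      · subst hli; simp [c, inv_mul_cancel₀ hp]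
      · simp
    have hrx : r • e i • x = e i • x := by
      rw [hr, sub_smul, smul_assoc, ha, smul_zero, sub_zero, ← mul_smul, h.idem]
    have hpow : ∀ t : ℕ, r ^ t • e i • x = e i • x := fun t => by
      induction t with
      | zero => rw [pow_zero, one_smul]
      | succ t ih => rw [pow_succ, mul_smul, hrx, ih]
    have : r ^ s ∈ J ^ s := Ideal.pow_mem_pow hrJ s
    rw [hs, Submodule.mem_bot] at this
    rw [← hpow s, this, zero_smul]

end IsBasicSplit

end Homs

/-! ### Computing Tor from a resolution that is minimal after tensoring -/

section Resolution

variable {R : Type u} [Ring R] (X : ℕ → Type u) [∀ n, AddCommGroup (X n)] [∀ n, Module R (X n)]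
  (d : ∀ n, X (n + 1) →ₗ[R] X n) {Z : Type u} [AddCommGroup Z] [Module R Z] (π : X 0 →ₗ[R] Z)

theorem exists_projectiveResolution (hX : ∀ n, Module.Projective R (X n))
    (hd : ∀ n, Function.Exact (d (n + 1)) (d n)) (hdπ : Function.Exact (d 0) π)
    (hπ : Function.Surjective π) :
    ∃ P : ProjectiveResolution (ModuleCat.of R Z), P.complex =
      ChainComplex.of (fun n => ModuleCat.of R (X n)) (fun n => ModuleCat.ofHom (d n))
        (fun n => ModuleCat.hom_ext (hd n).linearMap_comp_eq_zero) := by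
  set K := ChainComplex.of (fun n => ModuleCat.of R (X n)) (fun n => ModuleCat.ofHom (d n))
        (fun n => ModuleCat.hom_ext (hd n).linearMap_comp_eq_zero)
  have hKd : ∀ n, K.d (n + 1) n = ModuleCat.ofHom (d n) := fun n =>
    ChainComplex.of_d (fun n => ModuleCat.of R (X n)) (fun n => ModuleCat.ofHom (d n)) n
  have h0 : K.d 1 0 ≫ ModuleCat.ofHom π = 0 := by
    rw [hKd]
    exact ModuleCat.hom_ext hdπ.linearMap_comp_eq_zero
  refine ⟨{ complex := K
            projective := ?_
            π := (ChainComplex.toSingle₀Equiv _ _).symm ⟨ModuleCat.ofHom π, h0⟩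
            quasiIso := ⟨fun n => ?_⟩ }, rfl⟩
  · intro n
    have := hX n
    exact (ModuleCat.of R (X n)).projective_of_categoryTheory_projective
  · cases n with
    | zero =>
      rw [ChainComplex.quasiIsoAt₀_iff, ShortComplex.quasiIso_iff_of_zeros']
      · refine (ShortComplex.exact_and_epi_g_iff_of_iso (?_ : _ ≅ ShortComplex.mk
          (ModuleCat.ofHom (d 0)) (ModuleCat.ofHom π)
          (ModuleCat.hom_ext hdπ.linearMap_comp_eq_zero))).2
          ⟨(ShortComplex.ShortExact.moduleCat_exact_iff_function_exact _).2 hdπ,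
            (ModuleCat.epi_iff_surjective _).2 hπ⟩
        exact ShortComplex.isoMk (Iso.refl _) (Iso.refl _) (Iso.refl _)
          ((Category.id_comp _).trans ((hKd 0).symm.trans (Category.comp_id _).symm))
          ((Category.id_comp _).trans (Category.comp_id _).symm)
      all_goals rfl
    | succ n =>
      rw [quasiIsoAt_iff_exactAt']
      · rw [HomologicalComplex.exactAt_iff' _ (n + 1 + 1) (n + 1) n (by simp) (by simp)]
        refine (ShortComplex.ShortExact.moduleCat_exact_iff_function_exact _).2 ?_
        simp only [HomologicalComplex.sc', HomologicalComplex.shortComplexFunctor', hKd]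
        exact hd n
      · apply ChainComplex.exactAt_succ_single_obj

theorem nontrivial_homology_iff (K : HomologicalComplex AddCommGrpCat.{u} (ComplexShape.down ℕ))
    (hK : ∀ n, K.d (n + 1) n = 0) (n : ℕ) : Nontrivial (K.homology n) ↔ Nontrivial (K.X n) := by
  have hK' : ∀ i j, K.d i j = 0 := fun i j => by
    by_cases h : j + 1 = i
    · subst h; exact hK j
    · exact K.shape _ _ h
  have e : K.homology n ≅ K.X n :=
    (ShortComplex.LeftHomologyData.ofZeros (K.sc n) (hK' _ _) (hK' _ _)).homologyIso
  exact e.addCommGroupIsoToAddEquiv.toEquiv.nontrivial_congr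

/-- `Tor` is computed by any projective resolution which becomes minimal after tensoring. -/
theorem nontrivial_TorGroup_iff (N : Type u) [AddCommGroup N] [Module Rᵐᵒᵖ N]
    (hX : ∀ n, Module.Projective R (X n))
    (hd : ∀ n, Function.Exact (d (n + 1)) (d n)) (hdπ : Function.Exact (d 0) π)
    (hπ : Function.Surjective π) (hN : ∀ n, BalancedTensor.map R N (d n) = 0) (n : ℕ) :
    Nontrivial (TorGroup R N n Z) ↔ Nontrivial (BalancedTensor R N (X n)) := by
  obtain ⟨P, hP⟩ := exists_projectiveResolution X d π hX hd hdπ hπ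
  have e := P.isoLeftDerivedObj (balancedTensorFunctor R N) n
  rw [hP] at e
  unfold TorGroup
  refine e.addCommGroupIsoToAddEquiv.toEquiv.nontrivial_congr.trans
    (nontrivial_homology_iff _ (fun n => ?_) n)
  refine Eq.trans (congrArg (balancedTensorFunctor R N).map (ChainComplex.of_d
    (fun n => ModuleCat.of R (X n)) (fun n => ModuleCat.ofHom (d n)) n)) ?_
  exact AddCommGrpCat.hom_ext (hN n)

end Resolution

/-! ### Base change along a split ring homomorphism -/

section BaseChange

variable {A B C : Type u} [Ring A] [Ring B] [Ring C]

/-- An `A`-module regarded as a `C`-module by means of a ring homomorphism `C → A`. -/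
@[nolint unusedArguments]
def Restr (_ρ : C →+* A) (M : Type u) : Type u := M

section Restr

variable (ρ : C →+* A) (M : Type u) [AddCommGroup M] [Module A M]

instance : AddCommGroup (Restr ρ M) := inferInstanceAs (AddCommGroup M)

instance : Module C (Restr ρ M) := Module.compHom M ρ

variable {M} in
/-- An `A`-linear map is linear for the restricted module structures. -/
def Restr.map {M' : Type u} [AddCommGroup M'] [Module A M'] (f : M →ₗ[A] M') :
    Restr ρ M →ₗ[C] Restr ρ M' where
  toFun := f
  map_add' := f.map_add
  map_smul' c m := f.map_smul (ρ c) m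

theorem Restr.projective [Module.Projective C (Restr ρ A)] [Module.Finite A M]
    [Module.Projective A M] : Module.Projective C (Restr ρ M) := by
  obtain ⟨n, f, g, -, -, hfg⟩ := Module.Finite.exists_comp_eq_id_of_projective A M
  let s : Restr ρ M →ₗ[C] (Π₀ _ : Fin n, Restr ρ A) :=
    (DFinsupp.linearEquivFunOnFintype (R := C) (M := fun _ : Fin n => Restr ρ A)).symm.toLinearMap ∘ₗ
      LinearMap.pi fun j => Restr.map ρ (LinearMap.proj j ∘ₗ g)
  let t : (Π₀ _ : Fin n, Restr ρ A) →ₗ[C] Restr ρ M :=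
    ({ toFun := fun v => f v, map_add' := f.map_add, map_smul' := fun c v => f.map_smul (ρ c) v } :
      (Fin n → Restr ρ A) →ₗ[C] Restr ρ M) ∘ₗ
      (DFinsupp.linearEquivFunOnFintype (R := C) (M := fun _ : Fin n => Restr ρ A)).toLinearMap
  refine Module.Projective.of_split s t (LinearMap.ext fun x => ?_)
  simp only [t, s, LinearMap.comp_apply, LinearEquiv.coe_coe, LinearEquiv.apply_symm_apply]
  exact LinearMap.congr_fun hfg x

variable {M}

/-- Since `M` is projective over `C`, the surjection `f` has a `C`-linear section `s`, and `p ↦ p -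
s (f p)` retracts `P` onto the kernel. -/
theorem exists_retraction_ker {P : Type u} [AddCommGroup P] [Module A P] (f : P →ₗ[A] M)
    (hf : Function.Surjective f) [Module.Projective C (Restr ρ M)] :
    ∃ r : P →+ LinearMap.ker f,
      (∀ c p, r (ρ c • p) = ρ c • r p) ∧ ∀ p : LinearMap.ker f, r p = p := by
  obtain ⟨s', hs'⟩ := Module.projective_lifting_property (Restr.map ρ f) LinearMap.id hf
  let s : M →+ P := s'.toAddMonoidHom
  have hs : ∀ m, f (s m) = m := fun m => LinearMap.congr_fun hs' m
  have hsc : ∀ c m, s (ρ c • m) = ρ c • s m := fun c m => s'.map_smul c m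
  refine ⟨AddMonoidHom.mk' (fun p => ⟨p - s (f p), by
    rw [LinearMap.mem_ker, map_sub, hs, sub_self]⟩) fun p q => Subtype.ext ?_,
    fun c p => Subtype.ext ?_, fun p => Subtype.ext ?_⟩
  · simp only [map_add, Submodule.coe_add]
    abel
  · simp [hsc, smul_sub]
  · simp [LinearMap.mem_ker.1 p.2]

theorem Restr.projective_ker {P : Type u} [AddCommGroup P] [Module A P] (f : P →ₗ[A] M)
    (hf : Function.Surjective f) [Module.Projective C (Restr ρ M)]
    [Module.Projective C (Restr ρ P)] : Module.Projective C (Restr ρ (LinearMap.ker f)) := by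
  obtain ⟨r, hrc, hr⟩ := exists_retraction_ker ρ f hf
  exact Module.Projective.of_split (Restr.map ρ (LinearMap.ker f).subtype)
    ({ toFun := r, map_add' := r.map_add, map_smul' := hrc } :
      Restr ρ P →ₗ[C] Restr ρ (LinearMap.ker f))
    (LinearMap.ext hr)

end Restr

variable (ι : B →+* A) (σ : A →+* B)

/-- The base change of an `A`-module `P` along a ring homomorphism `σ : A → B` which has a
section `ι`: the quotient of `P` by `ker σ • P`. -/
@[nolint unusedArguments]
def BaseChange (_ι : B →+* A) (σ : A →+* B) (P : Type u) [AddCommGroup P] [Module A P] : Type u :=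
  P ⧸ (RingHom.ker σ • (⊤ : Submodule A P))

namespace BaseChange

section Defs

variable (P : Type u) [AddCommGroup P] [Module A P]

instance : AddCommGroup (BaseChange ι σ P) :=
  inferInstanceAs (AddCommGroup (P ⧸ (RingHom.ker σ • (⊤ : Submodule A P))))

instance : Module B (BaseChange ι σ P) :=
  Module.compHom (P ⧸ (RingHom.ker σ • (⊤ : Submodule A P))) ι

variable {P}

/-- The class of an element of `P` in the base change. -/
def mk : P →+ BaseChange ι σ P :=
  (Submodule.mkQ (RingHom.ker σ • (⊤ : Submodule A P))).toAddMonoidHom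

theorem mk_surjective : Function.Surjective (mk ι σ (P := P)) := Submodule.mkQ_surjective _

variable {ι σ} in
theorem mk_eq_zero {p : P} : mk ι σ p = 0 ↔ p ∈ RingHom.ker σ • (⊤ : Submodule A P) :=
  Submodule.Quotient.mk_eq_zero _

theorem mk_section_smul (b : B) (p : P) : mk ι σ (ι b • p) = b • mk ι σ p := rfl

variable {ι σ} (hσ : σ.comp ι = RingHom.id B)

include hσ in
theorem mk_smul (a : A) (p : P) : mk ι σ (a • p) = σ a • mk ι σ p := by
  rw [← mk_section_smul, ← sub_eq_zero, ← map_sub, ← sub_smul, mk_eq_zero]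
  refine Submodule.smul_mem_smul ?_ trivial
  rw [RingHom.mem_ker, map_sub, ← RingHom.comp_apply σ ι, hσ, RingHom.id_apply, sub_self]

variable {S Q : Type u} [Ring S] [AddCommGroup Q] [Module S Q]

include hσ in
/-- A semilinear map on `P` which is semilinear for a ring homomorphism that factors through
`σ` induces a semilinear map on the base change. -/
theorem exists_lift (τ : B →+* S) (ψ : A →+* S) (hψ : ∀ a, ψ a = τ (σ a)) (φ : P →ₛₗ[ψ] Q) :
    ∃ φ' : BaseChange ι σ P →ₛₗ[τ] Q, ∀ p, φ' (mk ι σ p) = φ p := by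
  have h0 : ∀ p : P, mk ι σ p = 0 → φ p = 0 := fun p hp => by
    refine Submodule.smul_induction_on (p := fun p => φ p = 0) (mk_eq_zero.1 hp)
      (fun a ha q _ => ?_) fun p q hp hq => ?_
    · rw [map_smulₛₗ, hψ, RingHom.mem_ker.1 ha, map_zero, zero_smul]
    · rw [map_add, hp, hq, add_zero]
  let φ' : BaseChange ι σ P →+ Q := QuotientAddGroup.lift
    (RingHom.ker σ • (⊤ : Submodule A P)).toAddSubgroup φ.toAddMonoidHom
    fun p hp => h0 p (mk_eq_zero.2 hp)
  have hφ' : ∀ p, φ' (mk ι σ p) = φ p := fun p => rfl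
  refine ⟨{ toFun := φ', map_add' := φ'.map_add, map_smul' := fun b x => ?_ }, hφ'⟩
  obtain ⟨p, rfl⟩ := mk_surjective ι σ x
  rw [← mk_section_smul, hφ', hφ', map_smulₛₗ, hψ, ← RingHom.comp_apply σ ι, hσ,
    RingHom.id_apply]

include hσ in
-- Base change does not affect functionals semilinear for a character that factors through `σ`. So
-- the top of the base change can be read off from `P`.
theorem exists_semilinear_ne_zero_iff (τ : B →+* S) (ψ : A →+* S) (hψ : ∀ a, ψ a = τ (σ a)) :
    (∃ φ : BaseChange ι σ P →ₛₗ[τ] Q, φ ≠ 0) ↔ ∃ φ : P →ₛₗ[ψ] Q, φ ≠ 0 := by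
  constructor
  · rintro ⟨φ, hφ⟩
    refine ⟨{ toFun := fun p => φ (mk ι σ p)
              map_add' := fun p q => by rw [map_add, map_add]
              map_smul' := fun a p => by rw [mk_smul hσ, map_smulₛₗ, hψ] }, fun h => hφ ?_⟩
    refine LinearMap.ext fun x => ?_
    obtain ⟨p, rfl⟩ := mk_surjective ι σ x
    exact LinearMap.congr_fun h p
  · rintro ⟨φ, hφ⟩
    obtain ⟨φ', hφ'⟩ := exists_lift hσ τ ψ hψ φ
    refine ⟨φ', fun h => hφ (LinearMap.ext fun p => ?_)⟩
    rw [← hφ', h]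
    rfl

variable {P' : Type u} [AddCommGroup P'] [Module A P']

theorem map_mem_smul_top (J : Ideal A) (f : P →ₗ[A] P') {p : P} (hp : p ∈ J • (⊤ : Submodule A P)) :
    f p ∈ J • (⊤ : Submodule A P') := by
  refine Submodule.smul_mono le_rfl (le_top : Submodule.map f ⊤ ≤ ⊤) ?_
  rw [← Submodule.map_smul'']
  exact Submodule.mem_map_of_mem hp

variable (ι σ) in
/-- The map of base changes induced by an `A`-linear map. -/
def map (f : P →ₗ[A] P') : BaseChange ι σ P →ₗ[B] BaseChange ι σ P' where
  toFun := Submodule.mapQ _ _ f fun _ hp => map_mem_smul_top _ f hp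
  map_add' := map_add _
  map_smul' b x := (Submodule.mapQ (RingHom.ker σ • ⊤) (RingHom.ker σ • ⊤) f
    fun _ hp => map_mem_smul_top _ f hp).map_smul (ι b) x

theorem map_mk (f : P →ₗ[A] P') (p : P) : map ι σ f (mk ι σ p) = mk ι σ (f p) := rfl

theorem map_surjective {f : P →ₗ[A] P'} (hf : Function.Surjective f) :
    Function.Surjective (map ι σ f) := fun x => by
  obtain ⟨p, rfl⟩ := mk_surjective ι σ x
  obtain ⟨q, rfl⟩ := hf p
  exact ⟨mk ι σ q, rfl⟩

include hσ in
theorem projective [Module.Finite A P] [Module.Projective A P] :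
    Module.Projective B (BaseChange ι σ P) := by
  obtain ⟨n, p, g, hg⟩ := exists_dualBasis A P
  choose g' hg' using fun j => exists_lift hσ (RingHom.id B) σ (fun _ => rfl)
    ({ toFun := fun p => σ (g j p)
       map_add' := fun p q => by rw [map_add, map_add]
       map_smul' := fun a p => by rw [map_smul, smul_eq_mul, map_mul, smul_eq_mul] } :
       P →ₛₗ[σ] B)
  refine Module.Projective.of_split (LinearMap.pi g')
    (∑ j, LinearMap.toSpanSingleton B _ (mk ι σ (p j)) ∘ₗ LinearMap.proj j : (Fin n → B) →ₗ[B] _)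
    (LinearMap.ext fun x => ?_)
  obtain ⟨q, rfl⟩ := mk_surjective ι σ x
  rw [LinearMap.id_apply]
  conv_rhs => rw [← hg q, map_sum]
  rw [LinearMap.comp_apply, LinearMap.sum_apply]
  refine Finset.sum_congr rfl fun j _ => ?_
  rw [mk_smul hσ]
  exact congrArg (· • mk ι σ (p j)) (hg' j q)

/-- Base change preserves right exactness. -/
theorem exact_of_range_eq_ker {P'' : Type u} [AddCommGroup P''] [Module A P''] {f : P' →ₗ[A] P''}
    {g : P →ₗ[A] P'} (hfg : Function.Exact g f)
    (hf : ∀ p, f p ∈ RingHom.ker σ • (⊤ : Submodule A P'') →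
      f p ∈ RingHom.ker σ • LinearMap.range f) :
    Function.Exact (map ι σ g) (map ι σ f) := by
  intro x
  constructor
  · obtain ⟨p, rfl⟩ := mk_surjective ι σ x
    intro hx
    rw [map_mk, mk_eq_zero] at hx
    have := hf p hx
    rw [← Submodule.map_top f, ← Submodule.map_smul''] at this
    -- By purity `f p = f q` with `q` in `ker σ • P'`. So `p - q` has the same class as `p` and lies
    -- in the image of `g`.
    obtain ⟨q, hq, hqp⟩ := this
    obtain ⟨r, hr⟩ := (hfg (p - q)).1 (by rw [map_sub, hqp, sub_self])
    refine ⟨mk ι σ r, ?_⟩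
    rw [map_mk, hr, map_sub, mk_eq_zero.2 hq, sub_zero]
  · rintro ⟨y, rfl⟩
    obtain ⟨p, rfl⟩ := mk_surjective ι σ y
    rw [map_mk, map_mk, hfg.apply_apply_eq_zero, map_zero]

/-- The kernel of a map `f` onto a module which is projective for the restriction along `ρ` is
pure with respect to `ker σ`, if `ker σ` is generated by the image of `ρ`. -/
theorem mem_smul_ker (ρ : C →+* A)
    (hρ : ∀ a ∈ RingHom.ker σ, a ∈ AddSubgroup.closure {a | ∃ c a', σ (ρ c) = 0 ∧ a = ρ c * a'})
    {f : P →ₗ[A] P'} (hf : Function.Surjective f) [Module.Projective C (Restr ρ P')]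
    {p : P} (hp : p ∈ RingHom.ker σ • (⊤ : Submodule A P)) (hfp : f p = 0) :
    p ∈ RingHom.ker σ • LinearMap.ker f := by
  obtain ⟨r, hrc, hr⟩ := exists_retraction_ker ρ f hf
  -- The retraction commutes with `ρ c`, hence carries `ρ c * a' • q` to `ρ c • r (a' • q)`, with `ρ
  -- c` in `ker σ`.
  have key : ∀ p ∈ RingHom.ker σ • (⊤ : Submodule A P),
      (r p : P) ∈ RingHom.ker σ • LinearMap.ker f := fun p hp => by
    refine Submodule.smul_induction_on (p := fun p => (r p : P) ∈ RingHom.ker σ • LinearMap.ker f) hp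
      (fun a ha q _ => ?_) fun p q hp hq => ?_
    · refine AddSubgroup.closure_induction
        (p := fun a _ => (r (a • q) : P) ∈ RingHom.ker σ • LinearMap.ker f) ?_ ?_ ?_ ?_ (hρ a ha)
      · rintro _ ⟨c, a', hc, rfl⟩
        rw [mul_smul, hrc]
        exact Submodule.smul_mem_smul hc (r (a' • q)).2
      · rw [zero_smul, map_zero]
        exact zero_mem _
      · intro a b _ _ ha hb
        rw [add_smul, map_add]
        exact add_mem ha hb
      · intro a _ ha
        rw [neg_smul, map_neg]
        exact neg_mem ha
    · rw [map_add]
      exact add_mem hp hq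
  have := key p hp
  rwa [hr ⟨p, hfp⟩] at this

end Defs

end BaseChange

/-! ### Base change of the minimal projective resolution -/

section MinimalResolution

variable [IsArtinianRing A] {ι : B →+* A} {σ : A →+* B} (hσ : σ.comp ι = RingHom.id B)
  (ρ : C →+* A)
  (hρ : ∀ a ∈ RingHom.ker σ, a ∈ AddSubgroup.closure {a | ∃ c a', σ (ρ c) = 0 ∧ a = ρ c * a'})
  (M : FGModuleCat.{u} A) [Module.Projective C (Restr ρ M)]

theorem projective_restr_iterSyzygy [Module.Projective C (Restr ρ A)] (n : ℕ) :
    Module.Projective C (Restr ρ (iterSyzygy M n)) := by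
  induction n with
  | zero => assumption
  | succ n ih =>
    have := Restr.projective ρ (projCover (iterSyzygy M n))
    exact Restr.projective_ker ρ (projCoverMap (iterSyzygy M n))
      (isProjectiveCover_projCoverMap _).surjective

theorem exact_presentationMap_projCoverMap (M : FGModuleCat.{u} A) :
    Function.Exact (presentationMap M) (projCoverMap M) := fun p => by
  constructor
  · intro hp
    obtain ⟨q, hq⟩ := (isProjectiveCover_projCoverMap (syzygy M)).surjective ⟨p, hp⟩
    exact ⟨q, congrArg Subtype.val hq⟩
  · rintro ⟨q, rfl⟩
    exact (projCoverMap (syzygy M) q).2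

theorem exact_presentationMap (M : FGModuleCat.{u} A) :
    Function.Exact (presentationMap (syzygy M)) (presentationMap M) := fun p =>
  (show presentationMap M p = 0 ↔ projCoverMap (syzygy M) p = 0 from
    ⟨fun h => Subtype.ext h, fun h => congrArg Subtype.val h⟩).trans
    (exact_presentationMap_projCoverMap (syzygy M) p)

include hρ in
-- The image of `presentationMap M` is the kernel of the projective cover of `M`. This kernel is
-- pure with respect to `ker σ`, because the cover splits over `C`.
theorem exact_map_presentationMap :
    Function.Exact (BaseChange.map ι σ (presentationMap (syzygy M)))
      (BaseChange.map ι σ (presentationMap M)) := by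
  have hM := exact_presentationMap_projCoverMap M
  refine BaseChange.exact_of_range_eq_ker (exact_presentationMap M) fun p hp => ?_
  rw [← LinearMap.exact_iff.1 hM]
  exact BaseChange.mem_smul_ker ρ hρ (isProjectiveCover_projCoverMap _).surjective hp
    ((hM _).2 ⟨p, rfl⟩)

theorem exact_map_projCoverMap (M : FGModuleCat.{u} A) :
    Function.Exact (BaseChange.map ι σ (presentationMap M))
      (BaseChange.map ι σ (projCoverMap M)) := by
  refine BaseChange.exact_of_range_eq_ker (exact_presentationMap_projCoverMap M) fun p hp => ?_
  rwa [LinearMap.range_eq_top.2 (isProjectiveCover_projCoverMap _).surjective]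

include hσ hρ in
theorem nontrivial_TorGroup_baseChange_iff [Module.Projective C (Restr ρ A)] (N : Type u) [AddCommGroup N] [Module Bᵐᵒᵖ N]
    {Z : Type u} [AddCommGroup Z] [Module B Z] (e : BaseChange ι σ M ≃ₗ[B] Z)
    (hN : ∀ n, BalancedTensor.map B N
      (BaseChange.map ι σ (presentationMap (iterSyzygy M n))) = 0) (n : ℕ) :
    Nontrivial (TorGroup B N n Z) ↔
      Nontrivial (BalancedTensor B N (BaseChange ι σ (projCover (iterSyzygy M n)))) := by
  refine nontrivial_TorGroup_iff (fun n => BaseChange ι σ (projCover (iterSyzygy M n)))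
    (fun n => BaseChange.map ι σ (presentationMap (iterSyzygy M n)))
    (e.toLinearMap ∘ₗ BaseChange.map ι σ (projCoverMap M)) N
    (fun n => BaseChange.projective hσ) (fun n => ?_) ?_ ?_ hN n
  · have := projective_restr_iterSyzygy ρ M n
    exact exact_map_presentationMap ρ hρ (iterSyzygy M n)
  · rw [LinearMap.exact_iff, LinearEquiv.ker_comp]
    exact (LinearMap.exact_iff.1 (exact_map_projCoverMap M))
  · exact e.surjective.comp (BaseChange.map_surjective (isProjectiveCover_projCoverMap _).surjective)

end MinimalResolution

end BaseChange

/-! ### Simple modules of a bound quiver algebra -/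

open PathAlgebra

variable {k V : Type u} [Field k] [Quiver.{u} V] [Fintype V]
  (I : Ideal (PathAlgebra k V)) [IsAdmissible I]

/-- The algebra map `kQ/I → k` "coefficient at the trivial path at `x`". -/
noncomputable def simpleAlgHom (x : V) : (PathAlgebra k V ⧸ I) →ₐ[k] k :=
  { simpleChar I x with commutes' := fun c => (vertexChar k x).commutes c }

theorem simpleAlgHom_mk (x : V) (f : PathAlgebra k V) :
    simpleAlgHom I x (Ideal.Quotient.mk I f) = vertexCoeff k x f := rfl

theorem simpleAlgHom_idem [DecidableEq V] (x y : V) :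
    simpleAlgHom I x (idem I y) = if x = y then 1 else 0 := by
  split_ifs with h
  · subst h; exact vertexCoeff_vertex_self k x
  · exact vertexCoeff_vertex_of_ne k (Ne.symm h)

theorem idem_mul_idem (x : V) : idem I x * idem I x = idem I x := by
  rw [idem, ← map_mul, vertex, ofPath_comp, Quiver.Path.comp_nil]

theorem sum_idem : ∑ x : V, idem I x = 1 := by
  simp only [idem]
  rw [← map_sum, ← one_def, map_one]

section BalancedTensor

variable (y : V) {M M' : Type u} [AddCommGroup M] [Module (PathAlgebra k V ⧸ I) M]
  [AddCommGroup M'] [Module (PathAlgebra k V ⧸ I) M']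

/-- The tensor product `k_y ⊗ M` is a quotient of `M` by the kernel of the character at `y`. A
vector outside `ker(χ_y) M` is detected by a linear functional vanishing there, and such a
functional is automatically semilinear. -/
theorem BalancedTensor.mk_eq_zero_of_semilinear {m : M}
    (hm : ∀ φ : M →ₛₗ[simpleChar I y] k, φ m = 0) (n : SimpleRight I y) :
    BalancedTensor.mk (PathAlgebra k V ⧸ I) (SimpleRight I y) n m = 0 := by
  let _ : Module k M := Module.compHom M (algebraMap k (PathAlgebra k V ⧸ I))
  have : IsScalarTower k (PathAlgebra k V ⧸ I) M := IsScalarTower.of_algebraMap_smul fun _ _ => rfl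
  set N : Submodule (PathAlgebra k V ⧸ I) M := RingHom.ker (simpleChar I y) • ⊤
  have hmN : m ∈ N := by
    by_contra hne
    obtain ⟨l, hl, hl0⟩ := Submodule.exists_dual_map_eq_bot_of_notMem
      (p := N.restrictScalars k) hne inferInstance
    have hl1 : ∀ x ∈ N, l x = 0 := fun x hx => by
      have : l x ∈ (N.restrictScalars k).map l := ⟨x, hx, rfl⟩
      rwa [hl0, Submodule.mem_bot] at this
    refine hl (hm { toFun := l, map_add' := l.map_add, map_smul' := fun a m => ?_ })
    have hmem : (a - algebraMap k _ (simpleChar I y a)) • m ∈ N := by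
      refine Submodule.smul_mem_smul ?_ trivial
      rw [RingHom.mem_ker, map_sub, sub_eq_zero]
      exact ((simpleAlgHom I y).commutes _).symm
    have := hl1 _ hmem
    rw [sub_smul, map_sub, sub_eq_zero] at this
    exact this.trans (l.map_smul _ _)
  refine Submodule.smul_induction_on
    (p := fun m => BalancedTensor.mk (PathAlgebra k V ⧸ I) (SimpleRight I y) n m = 0) hmN
    (fun a ha q _ => ?_) fun p q hp hq => ?_
  · have h1 : BalancedTensor.mk (PathAlgebra k V ⧸ I) (SimpleRight I y) (MulOpposite.op a • n) q =
        BalancedTensor.mk (PathAlgebra k V ⧸ I) (SimpleRight I y) n (a • q) := by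
      rw [← sub_eq_zero]
      exact (QuotientAddGroup.eq_zero_iff _).2 (AddSubgroup.subset_closure ⟨n, a, q, rfl⟩)
    have h2 : MulOpposite.op a • n = 0 :=
      (congrArg (fun c : k => c * (show k from n)) (RingHom.mem_ker.1 ha)).trans (zero_mul _)
    rw [← h1, h2, BalancedTensor.mk, TensorProduct.zero_tmul]
    rfl
  · rw [BalancedTensor.mk_add, hp, hq, add_zero]

theorem BalancedTensor.map_eq_zero_of_semilinear (f : M' →ₗ[PathAlgebra k V ⧸ I] M)
    (hf : ∀ (φ : M →ₛₗ[simpleChar I y] k) m, φ (f m) = 0) :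
    BalancedTensor.map (PathAlgebra k V ⧸ I) (SimpleRight I y) f = 0 :=
  BalancedTensor.hom_ext _ _ fun n m =>
    BalancedTensor.mk_eq_zero_of_semilinear I y (fun φ => hf φ m) n

theorem nontrivial_balancedTensor_iff :
    Nontrivial (BalancedTensor (PathAlgebra k V ⧸ I) (SimpleRight I y) M) ↔
      ∃ φ : M →ₛₗ[simpleChar I y] k, φ ≠ 0 := by
  constructor
  · intro h
    by_contra! hall
    have : AddMonoidHom.id (BalancedTensor (PathAlgebra k V ⧸ I) (SimpleRight I y) M) = 0 :=
      BalancedTensor.hom_ext _ _ fun n m =>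
        BalancedTensor.mk_eq_zero_of_semilinear I y
          (fun φ => by rw [hall φ, LinearMap.zero_apply]) n
    obtain ⟨t, ht⟩ := exists_ne (0 : BalancedTensor (PathAlgebra k V ⧸ I) (SimpleRight I y) M)
    exact ht (DFunLike.congr_fun this t)
  · rintro ⟨φ, hφ⟩
    let B : SimpleRight I y ⊗[ℤ] M →+ k := (TensorProduct.lift (LinearMap.mk₂ ℤ
      (fun (n : SimpleRight I y) (m : M) => (show k from n) * φ m)
      (fun n n' m => add_mul (show k from n) (show k from n') (φ m))
      (fun c n m => smul_mul_assoc c (show k from n) (φ m))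
      (fun n m m' => by rw [map_add, mul_add])
      (fun c n m => by rw [map_zsmul, mul_smul_comm]))).toAddMonoidHom
    have hB : ∀ t ∈ balancedRel (PathAlgebra k V ⧸ I) (SimpleRight I y) M, B t = 0 := fun t ht => by
      refine (AddSubgroup.closure_le B.ker).2 ?_ ht
      rintro _ ⟨n, r, m, rfl⟩
      change B _ = 0
      rw [map_sub, sub_eq_zero]
      change simpleChar I y r * (show k from n) * φ m = (show k from n) * φ (r • m)
      rw [map_smulₛₗ, smul_eq_mul]
      ring
    obtain ⟨m, hm⟩ := DFunLike.ne_iff.1 hφ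
    refine ⟨BalancedTensor.mk _ _ (show SimpleRight I y from (1 : k)) m, 0, fun h => hm ?_⟩
    have := hB _ ((QuotientAddGroup.eq_zero_iff _).1 h)
    exact (one_mul (φ m)).symm.trans this

end BalancedTensor

/-! ### The enveloping algebra is split basic -/

section Env

/-- The algebra map `Λ ⊗ Λᵒᵖ → Λ` which evaluates the second factor at the vertex `x`. -/
noncomputable def evalRight (x : V) :
    Env k (PathAlgebra k V ⧸ I) →ₐ[k] (PathAlgebra k V ⧸ I) :=
  Algebra.TensorProduct.lift (AlgHom.id k _)
    ((Algebra.ofId k (PathAlgebra k V ⧸ I)).comp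
      ((simpleAlgHom I x).fromOpposite fun _ _ => mul_comm _ _))
    fun a b => (Algebra.commutes (simpleAlgHom I x b.unop) a).symm

theorem evalRight_tmul (x : V) (a b : PathAlgebra k V ⧸ I) :
    evalRight I x (a ⊗ₜ MulOpposite.op b) = simpleAlgHom I x b • a := by
  rw [Algebra.smul_def, Algebra.commutes]
  exact Algebra.TensorProduct.lift_tmul _ _ _ _ _

/-- The character of the simple bimodule at a pair of vertices. -/
noncomputable def pairChar (i : V × V) : Env k (PathAlgebra k V ⧸ I) →ₐ[k] k :=
  (simpleAlgHom I i.1).comp (evalRight I i.2)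

theorem pairChar_tmul (i : V × V) (a b : PathAlgebra k V ⧸ I) :
    pairChar I i (a ⊗ₜ MulOpposite.op b) = simpleAlgHom I i.1 a * simpleAlgHom I i.2 b := by
  rw [pairChar, AlgHom.comp_apply, evalRight_tmul, map_smul, smul_eq_mul, mul_comm]

/-- The idempotent of the enveloping algebra at a pair of vertices. -/
noncomputable def pairIdem (i : V × V) : Env k (PathAlgebra k V ⧸ I) :=
  idem I i.1 ⊗ₜ MulOpposite.op (idem I i.2)

theorem pairChar_pairIdem [DecidableEq V] (i j : V × V) :
    pairChar I i (pairIdem I j) = if i = j then 1 else 0 := by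
  rw [pairIdem, pairChar_tmul, simpleAlgHom_idem, simpleAlgHom_idem]
  simp only [Prod.ext_iff]
  split_ifs <;> simp_all

/-- The subspace of the enveloping algebra spanned by the pairs of paths of total length at
least `s`. -/
noncomputable def lengthFiltration (s : ℕ) : Submodule k (Env k (PathAlgebra k V ⧸ I)) :=
  Submodule.span k {t | ∃ p q : QPath V, s ≤ p.2.2.length + q.2.2.length ∧
    t = Ideal.Quotient.mk I (ofPath k p) ⊗ₜ MulOpposite.op (Ideal.Quotient.mk I (ofPath k q))}

theorem ofPath_mul_ofPath_cases (q p : QPath V) : ofPath k q * ofPath k p = 0 ∨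
    ∃ r : QPath V, r.2.2.length = p.2.2.length + q.2.2.length ∧
      ofPath k q * ofPath k p = ofPath k r := by
  obtain ⟨x, y, p⟩ := p
  obtain ⟨y', z, q⟩ := q
  by_cases h : y = y'
  · subst h
    exact Or.inr ⟨⟨x, z, p.comp q⟩, Quiver.Path.length_comp _ _, ofPath_comp k q p⟩
  · exact Or.inl (ofPath_mul_of_ne k h)

theorem lengthFiltration_mul_le (s t : ℕ) :
    lengthFiltration I s * lengthFiltration I t ≤ lengthFiltration I (s + t) := by
  rw [lengthFiltration, lengthFiltration, Submodule.span_mul_span, Submodule.span_le]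
  rintro _ ⟨_, ⟨p, q, hpq, rfl⟩, _, ⟨p', q', hpq', rfl⟩, rfl⟩
  simp only [Algebra.TensorProduct.tmul_mul_tmul, ← MulOpposite.op_mul, ← map_mul]
  obtain hp | ⟨r, hr, hp⟩ := ofPath_mul_ofPath_cases (k := k) p p'
  · rw [hp, map_zero, TensorProduct.zero_tmul]
    exact zero_mem _
  obtain hq | ⟨r', hr', hq⟩ := ofPath_mul_ofPath_cases (k := k) q' q
  · rw [hq, map_zero, MulOpposite.op_zero, TensorProduct.tmul_zero]
    exact zero_mem _
  rw [hp, hq]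
  exact Submodule.subset_span ⟨r, r', by omega, rfl⟩

theorem mk_ofPath_eq_zero {m : ℕ} (hm : arrowIdeal k V ^ m ≤ I) {p : QPath V}
    (hp : m ≤ p.2.2.length) : Ideal.Quotient.mk I (ofPath k p) = 0 :=
  Ideal.Quotient.eq_zero_iff_mem.2 (hm (Ideal.pow_le_pow_right hp
    (ofPath_mem_arrowIdeal_pow k p.2.2)))

theorem exists_lengthFiltration_eq_bot : ∃ s : ℕ, lengthFiltration I (s + 1) = ⊥ := by
  obtain ⟨m, -, hm⟩ := IsAdmissible.exists_pow_le (I := I)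
  -- If the total length exceeds `2 * m`, one of the two paths has length at least `m` and so lies
  -- in `I`.
  refine ⟨2 * m, (Submodule.span_eq_bot).2 ?_⟩
  rintro _ ⟨p, q, hpq, rfl⟩
  obtain h | h : m ≤ p.2.2.length ∨ m ≤ q.2.2.length := by omega
  · rw [mk_ofPath_eq_zero I hm h, TensorProduct.zero_tmul]
  · rw [mk_ofPath_eq_zero I hm h, MulOpposite.op_zero, TensorProduct.tmul_zero]

/-- Modulo pairs of paths of positive total length only the pairs of trivial paths survive, and the
characters read off their coefficients. -/
theorem sub_sum_mem_lengthFiltration (t : Env k (PathAlgebra k V ⧸ I)) :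
    t - ∑ i, pairChar I i t • pairIdem I i ∈ lengthFiltration I 1 := by
  classical
  let T : Env k (PathAlgebra k V ⧸ I) →ₗ[k] Env k (PathAlgebra k V ⧸ I) :=
    LinearMap.id - ∑ i, (pairChar I i).toLinearMap.smulRight (pairIdem I i)
  have hT : ∀ t, T t = t - ∑ i, pairChar I i t • pairIdem I i := fun t => by simp [T]
  rw [← hT]
  induction t using TensorProduct.induction_on with
  | zero => rw [map_zero]; exact zero_mem _
  | add s t hs ht => rw [map_add]; exact add_mem hs ht
  | tmul a b =>
  obtain ⟨b, rfl⟩ := MulOpposite.op_surjective b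
  obtain ⟨f, rfl⟩ := Ideal.Quotient.mk_surjective a
  obtain ⟨g, rfl⟩ := Ideal.Quotient.mk_surjective b
  induction f using PathAlgebra.induction with
  | zero => rw [map_zero, TensorProduct.zero_tmul, map_zero]; exact zero_mem _
  | add f f' h h' => rw [map_add, TensorProduct.add_tmul, map_add]; exact add_mem h h'
  | smul c p =>
  induction g using PathAlgebra.induction with
  | zero =>
    rw [map_zero, MulOpposite.op_zero, TensorProduct.tmul_zero, map_zero]; exact zero_mem _
  | add f f' h h' =>
    rw [map_add, MulOpposite.op_add, TensorProduct.tmul_add, map_add]; exact add_mem h h'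
  | smul c' q =>
  have hmk : ∀ (c : k) (p : QPath V), Ideal.Quotient.mk I (c • ofPath k p) =
    c • Ideal.Quotient.mk I (ofPath k p) := fun _ _ => rfl
  rw [hmk, hmk, MulOpposite.op_smul, ← TensorProduct.smul_tmul', TensorProduct.tmul_smul,
    map_smul, map_smul]
  refine Submodule.smul_mem _ _ (Submodule.smul_mem _ _ ?_)
  rw [hT]
  by_cases hpq : 1 ≤ p.2.2.length + q.2.2.length
  · rw [Finset.sum_eq_zero, sub_zero]
    · exact Submodule.subset_span ⟨p, q, hpq, rfl⟩
    · intro i _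
      rw [pairChar_tmul, simpleAlgHom_mk, simpleAlgHom_mk]
      obtain h | h : p.2.2.length ≠ 0 ∨ q.2.2.length ≠ 0 := by omega
      · rw [vertexCoeff_ofPath_pos k p.2.2 h, zero_mul, zero_smul]
      · rw [vertexCoeff_ofPath_pos k q.2.2 h, mul_zero, zero_smul]
  · obtain ⟨x, y, p⟩ := p
    obtain ⟨x', y', q⟩ := q
    cases p with
    | cons => simp at hpq
    | nil =>
    cases q with
    | cons => simp at hpq
    | nil =>
    change pairIdem I (x, x') - ∑ i, pairChar I i (pairIdem I (x, x')) • pairIdem I i ∈ _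
    simp only [pairChar_pairIdem, ite_smul, one_smul, zero_smul, Finset.sum_ite_eq',
      Finset.mem_univ, if_true, sub_self]
    exact zero_mem _

theorem isBasicSplit_env [DecidableEq V] : IsBasicSplit (pairIdem I) (pairChar I) where
  sum_eq_one := by
    simp only [pairIdem, Fintype.sum_prod_type, ← TensorProduct.tmul_sum, ← TensorProduct.sum_tmul,
      ← Finset.op_sum, sum_idem]
    rfl
  idem i := by
    rw [pairIdem, Algebra.TensorProduct.tmul_mul_tmul, ← MulOpposite.op_mul, idem_mul_idem,
      idem_mul_idem]
  char_idem := pairChar_pairIdem I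
  nilpotent := by
    obtain ⟨s, hs⟩ := exists_lengthFiltration_eq_bot I
    set J : Ideal (Env k (PathAlgebra k V ⧸ I)) := ⨅ i, RingHom.ker (pairChar I i) with hJ
    -- The common kernel `J` lies in the first step of the length filtration, which is
    -- multiplicative and eventually zero.
    have key : ∀ (s : ℕ), ∀ a ∈ J ^ (s + 1), a ∈ lengthFiltration I (s + 1) := fun s => by
      have h1 : ∀ a ∈ J, a ∈ lengthFiltration I 1 := fun a ha => by
        have := sub_sum_mem_lengthFiltration I a
        rwa [Finset.sum_eq_zero, sub_zero] at this
        intro i _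
        rw [RingHom.mem_ker.1 ((Submodule.mem_iInf _).1 ha i), zero_smul]
      induction s with
      | zero =>
        intro a ha
        rw [zero_add, Submodule.pow_one] at ha
        exact h1 a ha
      | succ s ih =>
        intro a ha
        rw [Submodule.pow_succ, ← Ideal.smul_eq_mul] at ha
        refine Submodule.smul_induction_on (p := fun a => a ∈ lengthFiltration I (s + 1 + 1)) ha
          (fun a ha b hb => ?_) fun a b => add_mem
        exact lengthFiltration_mul_le I (s + 1) 1 (Submodule.mul_mem_mul (ih a ha) (h1 b hb))
    refine ⟨s + 1, (Submodule.eq_bot_iff _).2 fun a ha => ?_⟩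
    have := key s a ha
    rwa [hs, Submodule.mem_bot] at this

end Env

/-! ### The bimodule resolution, Tor of simples, and the main equivalence -/

/-- The left embedding of an algebra into its enveloping algebra. -/
noncomputable abbrev envLeft (k Λ : Type u) [Field k] [Ring Λ] [Algebra k Λ] : Λ →+* Env k Λ :=
  (Algebra.TensorProduct.includeLeft : Λ →ₐ[k] Env k Λ)

/-- The right embedding of an algebra into its enveloping algebra. -/
noncomputable abbrev envRight (k Λ : Type u) [Field k] [Ring Λ] [Algebra k Λ] : Λᵐᵒᵖ →+* Env k Λ :=
  (Algebra.TensorProduct.includeRight : Λᵐᵒᵖ →ₐ[k] Env k Λ)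

instance projective_restr_env (Λ : Type u) [Ring Λ] [Algebra k Λ] :
    Module.Projective Λᵐᵒᵖ (Restr (envRight k Λ) (Env k Λ)) := by
  let e : Λᵐᵒᵖ ⊗[k] Λ ≃+ Restr (envRight k Λ) (Env k Λ) :=
    (TensorProduct.comm k Λᵐᵒᵖ Λ).toAddEquiv
  refine Module.Projective.of_equiv' (M := Λᵐᵒᵖ ⊗[k] Λ) (R := Λᵐᵒᵖ)
    { e with map_smul' := fun c t => ?_ }
  change e (c • t) = c • e t
  induction t using TensorProduct.induction_on with
  | zero => rw [smul_zero, map_zero, smul_zero]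
  | add s t hs ht => rw [smul_add, map_add, hs, ht, map_add, smul_add]
  | tmul a b =>
    change b ⊗ₜ[k] (c * a) = ((1 : Λ) ⊗ₜ[k] c) * (b ⊗ₜ[k] a)
    rw [Algebra.TensorProduct.tmul_mul_tmul, one_mul]

instance projective_restr_bimod (Λ : Type u) [Ring Λ] [Algebra k Λ] :
    Module.Projective Λᵐᵒᵖ (Restr (envRight k Λ) (Bimod Λ)) := by
  let e : Λᵐᵒᵖ ≃+ Restr (envRight k Λ) (Bimod Λ) :=
    (MulOpposite.opAddEquiv (α := Λ)).symm
  refine Module.Projective.of_equiv' (M := Λᵐᵒᵖ) (R := Λᵐᵒᵖ) { e with map_smul' := fun c t => ?_ }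
  change t.unop * c.unop = (1 : Λ) * (t.unop * c.unop)
  rw [one_mul]

/-- The ring homomorphism `Λ ⊗ Λᵒᵖ → Λ` which evaluates the second factor at the vertex `x`. -/
noncomputable abbrev evalRightHom (x : V) :
    Env k (PathAlgebra k V ⧸ I) →+* (PathAlgebra k V ⧸ I) := evalRight I x

theorem evalRight_comp_envLeft (x : V) :
    (evalRightHom I x).comp (envLeft k _) = RingHom.id _ :=
  RingHom.ext fun a => by
    have := evalRight_tmul I x a 1
    rwa [map_one, one_smul] at this

/-- The identity `a ⊗ b - χ_x(b) a ⊗ 1 = (1 ⊗ (b - χ_x(b))) (a ⊗ 1)` shows that the kernel is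
generated from the right factor. This is what makes splitting over right modules sufficient for
purity. -/
theorem ker_evalRight (x : V) :
    ∀ a ∈ RingHom.ker (evalRightHom I x),
      a ∈ AddSubgroup.closure {a | ∃ c a',
        (evalRightHom I x) (envRight k _ c) = 0 ∧
          a = envRight k _ c * a'} := by
  intro a ha
  suffices H : ∀ t : Env k (PathAlgebra k V ⧸ I), t - envLeft k _ (evalRight I x t) ∈
      AddSubgroup.closure {a | ∃ c a',
        (evalRightHom I x) (envRight k _ c) = 0 ∧
          a = envRight k _ c * a'} by
    have := H a
    rwa [show evalRight I x a = 0 from ha, map_zero, sub_zero] at this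
  intro t
  induction t using TensorProduct.induction_on with
  | zero => rw [map_zero, map_zero, sub_zero]; exact zero_mem _
  | add s t hs ht => rw [map_add, map_add, add_sub_add_comm]; exact add_mem hs ht
  | tmul a b =>
    obtain ⟨b, rfl⟩ := MulOpposite.op_surjective b
    refine AddSubgroup.subset_closure
      ⟨MulOpposite.op (b - algebraMap k _ (simpleAlgHom I x b)), a ⊗ₜ 1, ?_, ?_⟩
    · refine (evalRight_tmul I x 1 _).trans ?_
      rw [map_sub, AlgHom.commutes, Algebra.algebraMap_self_apply, sub_self, zero_smul]
    · change _ = (1 ⊗ₜ _) * (a ⊗ₜ[k] 1)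
      rw [evalRight_tmul, Algebra.TensorProduct.tmul_mul_tmul, one_mul, mul_one,
        MulOpposite.op_sub, TensorProduct.tmul_sub, Algebra.algebraMap_eq_smul_one,
        MulOpposite.op_smul, TensorProduct.tmul_smul, TensorProduct.smul_tmul']
      rfl

/-- Base change along evaluation at `x` is the functor `- ⊗_Λ _xk`, and `Λ ⊗_Λ _xk` is `_xk`. The
isomorphism is induced by the character at `x`. -/
theorem exists_baseChange_equiv (x : V) :
    Nonempty (BaseChange (envLeft k _)
      (evalRightHom I x) (Bimod (PathAlgebra k V ⧸ I))
        ≃ₗ[PathAlgebra k V ⧸ I] SimpleLeft I x) := by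
  let χ : Bimod (PathAlgebra k V ⧸ I) →+ SimpleLeft I x :=
    (simpleAlgHom I x).toLinearMap.toAddMonoidHom
  have hχ : ∀ (t : Env k (PathAlgebra k V ⧸ I)) b, χ (t • b) = evalRightHom I x t • χ b :=
    fun t b => by
      induction t using TensorProduct.induction_on with
      | zero =>
        refine (congrArg χ (zero_smul (Env k (PathAlgebra k V ⧸ I)) b)).trans ?_
        rw [map_zero, map_zero, zero_smul]
      | add s t hs ht => rw [add_smul, map_add, hs, ht, map_add, add_smul]
      | tmul a c =>
        obtain ⟨c, rfl⟩ := MulOpposite.op_surjective c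
        obtain ⟨b, rfl⟩ := Bimod.of.surjective b
        refine Eq.trans (b := simpleAlgHom I x (a * (b * c))) rfl ?_
        refine Eq.trans ?_ (b := simpleAlgHom I x (evalRight I x (a ⊗ₜ MulOpposite.op c)) *
          simpleAlgHom I x b) rfl
        rw [evalRight_tmul, map_mul, map_mul, map_smul, smul_eq_mul]
        ring
  obtain ⟨φ, hφ⟩ := BaseChange.exists_lift (evalRight_comp_envLeft I x)
    (RingHom.id _) (evalRightHom I x) (fun _ => rfl)
    ({ toFun := χ, map_add' := χ.map_add, map_smul' := hχ } :
      Bimod (PathAlgebra k V ⧸ I) →ₛₗ[evalRightHom I x] SimpleLeft I x)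
  refine ⟨LinearEquiv.ofBijective φ ⟨(injective_iff_map_eq_zero φ).2 fun z hz => ?_, fun c => ?_⟩⟩
  · obtain ⟨b, rfl⟩ := BaseChange.mk_surjective _ _ z
    obtain ⟨b, rfl⟩ := Bimod.of.surjective b
    rw [hφ] at hz
    have hz' : simpleAlgHom I x b = 0 := hz
    rw [BaseChange.mk_eq_zero]
    have hb : ((1 : PathAlgebra k V ⧸ I) ⊗ₜ[k] MulOpposite.op b) •
        (Bimod.of (1 : PathAlgebra k V ⧸ I)) = Bimod.of b := by
      rw [Bimod.tmul_smul, one_smul]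
      exact one_mul b
    rw [← hb]
    refine Submodule.smul_mem_smul ?_ trivial
    refine (evalRight_tmul I x 1 b).trans ?_
    rw [hz', zero_smul]
  · refine ⟨BaseChange.mk _ _ (Bimod.of (algebraMap k _ c)), ?_⟩
    rw [hφ]
    exact (simpleAlgHom I x).commutes c

theorem pairIdem_smul_bimod (y x : V) (a : PathAlgebra k V ⧸ I) :
    pairIdem I (y, x) • Bimod.of a = Bimod.of (idem I y * a * idem I x) := by
  rw [pairIdem, Bimod.tmul_smul, mul_assoc]
  rfl

/-- The action on the dual is by precomposition, which interchanges left and right: `y(DΛ)x` is the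
dual of `xΛy`. -/
theorem exists_pairIdem_smul_dual_ne_zero_iff (y x : V) :
    (∃ f : Bimod (KDual k (PathAlgebra k V ⧸ I)), pairIdem I (y, x) • f ≠ 0) ↔
      ∃ a, idem I x * a * idem I y ≠ 0 := by
  have key : ∀ (f : KDual k (PathAlgebra k V ⧸ I)) a,
      (show (PathAlgebra k V ⧸ I) →ₗ[k] k from pairIdem I (y, x) • Bimod.of f) a =
        (show (PathAlgebra k V ⧸ I) →ₗ[k] k from f) (idem I x * a * idem I y) := fun f a => by
    rw [mul_assoc]
    rfl
  constructor
  · rintro ⟨f, hf⟩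
    by_contra! hall
    refine hf (LinearMap.ext fun a => (key f a).trans ?_)
    rw [hall, map_zero]
    rfl
  · rintro ⟨a, ha⟩
    obtain ⟨l, hl⟩ := not_forall.1 (mt (Module.forall_dual_apply_eq_zero_iff k _).1 ha)
    refine ⟨Bimod.of (show KDual k (PathAlgebra k V ⧸ I) from l), fun h => hl ?_⟩
    exact (key l a).symm.trans (LinearMap.congr_fun h a)

variable [∀ x y : V, Finite (x ⟶ y)]

/-- The terms of the minimal bimodule resolution of `kQ/I`. -/
noncomputable abbrev bimodResolution (n : ℕ) : FGModuleCat.{u} (Env k (PathAlgebra k V ⧸ I)) :=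
  projCover (iterSyzygy (FGModuleCat.of (Env k (PathAlgebra k V ⧸ I))
    (Bimod (PathAlgebra k V ⧸ I))) n)

theorem nontrivial_TorGroup_simple_iff (y x : V) (n : ℕ) :
    Nontrivial (TorGroup (PathAlgebra k V ⧸ I) (SimpleRight I y) n (SimpleLeft I x)) ↔
      ∃ φ : bimodResolution I n →ₛₗ[(pairChar I (y, x) : Env k (PathAlgebra k V ⧸ I) →+* k)] k,
        φ ≠ 0 := by
  obtain ⟨e⟩ := exists_baseChange_equiv I x
  have hσ := evalRight_comp_envLeft I x
  have : Module.Projective (PathAlgebra k V ⧸ I)ᵐᵒᵖ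
      (Restr (envRight k (PathAlgebra k V ⧸ I)) (FGModuleCat.of (Env k (PathAlgebra k V ⧸ I))
        (Bimod (PathAlgebra k V ⧸ I)))) := projective_restr_bimod (PathAlgebra k V ⧸ I)
  rw [nontrivial_TorGroup_baseChange_iff hσ (envRight k _) (ker_evalRight I x)
    (FGModuleCat.of (Env k (PathAlgebra k V ⧸ I)) (Bimod (PathAlgebra k V ⧸ I)))
    (SimpleRight I y) e ?_ n, nontrivial_balancedTensor_iff,
    BaseChange.exists_semilinear_ne_zero_iff hσ (simpleChar I y)
      (pairChar I (y, x) : Env k (PathAlgebra k V ⧸ I) →+* k) (fun _ => rfl)]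
  -- Each differential lands in the kernel of a projective cover, on which every functional
  -- semilinear for the character at `(y, x)` vanishes. Hence it becomes zero after `k_y ⊗ -`.
  intro n
  refine BalancedTensor.map_eq_zero_of_semilinear I y _ fun φ z => ?_
  obtain ⟨p, rfl⟩ := BaseChange.mk_surjective _ _ z
  let ψ : bimodResolution I n →ₛₗ[(pairChar I (y, x) : Env k (PathAlgebra k V ⧸ I) →+* k)] k :=
    { toFun := fun p => φ (BaseChange.mk _ _ p)
      map_add' := fun p q => by rw [map_add, map_add]
      map_smul' := fun a p => by rw [BaseChange.mk_smul hσ, map_smulₛₗ]; rfl }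
  exact (isProjectiveCover_projCoverMap _).semilinear_eq_zero (pairChar I (y, x)) ψ
    ((exact_presentationMap_projCoverMap _).apply_apply_eq_zero p)

theorem infinite_hom_tauBimod_iff (X : Type u) [AddCommGroup X]
    [Module (Env k (PathAlgebra k V ⧸ I)) X] :
    {n : ℕ+ | Nontrivial (X →ₗ[Env k (PathAlgebra k V ⧸ I)]
        tauBimod k (PathAlgebra k V ⧸ I) n)}.Infinite ↔
      ∃ y x : V, (∃ z : X, pairIdem I (y, x) • z ≠ 0) ∧ IsInfiniteGraded fun n : ℕ =>
        TorGroup (PathAlgebra k V ⧸ I) (SimpleRight I y) n (SimpleLeft I x) := by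
  classical
  rw [infinite_hom_nARTranslate_iff]
  simp only [(isBasicSplit_env I).nontrivial_hom_iff, IsInfiniteGraded,
    nontrivial_TorGroup_simple_iff]
  refine Iff.trans ?_ (Prod.exists (p := fun i : V × V => (∃ z : X, pairIdem I i • z ≠ 0) ∧
    {n : ℕ | ∃ φ : bimodResolution I n →ₛₗ[(pairChar I i : Env k (PathAlgebra k V ⧸ I) →+* k)] k,
      φ ≠ 0}.Infinite))
  constructor
  · intro h
    by_contra! hall
    -- Pigeonhole over the finitely many pairs of vertices: a finite union of finite sets of degrees
    -- is finite.
    refine h ((Set.finite_iUnion (fun i : {i : V × V // ∃ z : X, pairIdem I i • z ≠ 0} =>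
      hall i.1 i.2)).subset ?_)
    rintro n ⟨i, hi, φ⟩
    exact Set.mem_iUnion.2 ⟨⟨i, hi⟩, φ⟩
  · rintro ⟨i, hi, h⟩
    exact h.mono fun n hn => ⟨i, hi, hn⟩

end BQ

theorem mainTheorem1 {k V : Type u} [Field k] [Quiver.{u} V] [Fintype V]
    [∀ x y : V, Finite (x ⟶ y)] (I : Ideal (BQ.PathAlgebra k V)) [BQ.IsAdmissible I] :
    (BQ.HasInfiniteCoPlusGlobalDimension I ↔
      BQ.IsInfiniteGraded (BQ.TauHHCohomology k (BQ.PathAlgebra k V ⧸ I)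
        (BQ.PathAlgebra k V ⧸ I))) ∧
    (BQ.HasInfinitePlusGlobalDimension I ↔
      BQ.IsInfiniteGraded (BQ.TauHHHomology k (BQ.PathAlgebra k V ⧸ I)
        (BQ.PathAlgebra k V ⧸ I))) := by
  constructor
  · have h : ∀ n, Nontrivial (BQ.TauHHCohomology k (BQ.PathAlgebra k V ⧸ I)
        (BQ.PathAlgebra k V ⧸ I) n) ↔ Nontrivial (BQ.Bimod (BQ.PathAlgebra k V ⧸ I)
          →ₗ[BQ.Env k (BQ.PathAlgebra k V ⧸ I)] BQ.tauBimod k (BQ.PathAlgebra k V ⧸ I) n) :=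
      fun n => BQ.nontrivial_KDual_iff k _
    rw [BQ.IsInfiniteGraded]
    simp only [h]
    rw [BQ.infinite_hom_tauBimod_iff]
    refine exists_congr fun y => exists_congr fun x => and_congr_left fun _ => ?_
    exact exists_congr fun a => not_congr
      (Eq.congr (BQ.pairIdem_smul_bimod I y x a).symm rfl)
  · have h := BQ.infinite_hom_tauBimod_iff I (BQ.Bimod (BQ.KDual k (BQ.PathAlgebra k V ⧸ I)))
    refine Iff.trans ?_ h.symm
    -- The vertices trade places because the idempotents act on `DΛ` from opposite sides.
    rw [exists_comm]
    refine exists_congr fun y => exists_congr fun x => and_congr_left fun _ => ?_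
    exact (BQ.exists_pairIdem_smul_dual_ne_zero_iff I x y).symm
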